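/- Let $\mathbb{D}$ be the unit disc with normalized area measure $A$, and let $|I|$ denote the normalized length of an arc $I\subset\mathbb{T}$ (so $|\mathbb{T}|=1$). Arcs are half-open, containing their right but not their left endpoint. A *dyadic grid* $\mathcal{D}$ is a collection of arcs of lengths $2^{-n}$, $n\ge 0$, with $\mathbb{T}\in\mathcal{D}$, such that for every $I\in\mathcal{D}$ the family $\{J\in\mathcal{D}:|J|=|I|\}$ is a partition of $\mathbb{T}$ and $I$ is the union of two different arcs of $\mathcal{D}$ of equal length. For an arc $I$ let $$S(I)=\{z\in\mathbb{D}: z/|z|\in I,\ 1-|z|<|I|\},\qquad T(I)=\{z\in\mathbb{D}: z/|z|\in I,\ \tfrac12<\tfrac{1-|z|}{|I|}\le 1\}.$$ For $\Omega\subset\mathbb{D}$ put $M_{\mathcal{D},\Omega}f(z)=\sup\frac{1}{A(S(I))}\int_{S(I)\cap\Omega}|f|\,dA$, the supremum being over all $I\in\mathcal{D}$ with $z\in S(I)\cap\Omega$. A non-negative integrable function $w$ on $\Omega$ belongs to $B_{1,\mathcal{D},\Omega}$ if there is $C>0$ with $M_{\mathcal{D},\Omega}w\le Cw$ a.e. in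 $\Omega$; $[w]_{B_{1,\mathcal{D},\Omega}}$ is the infimum of all such $C$, and $\Omega$ is dropped from the notation when $\Omega=\mathbb{D}$. For $z,\zeta\in\mathbb{D}\setminus\{0\}$ let $\mathcal{I}_z\in\mathcal{D}$ be the unique arc with $z\in T(\mathcal{I}_z)$, let $P$ be the smallest arc of $\mathcal{D}$ containing $\mathcal{I}_z\cup\mathcal{I}_\zeta$, and $\beta_{\mathcal{D}}(z,\zeta)=\log_2\frac{|P|}{\min\{|\mathcal{I}_z|,|\mathcal{I}_\zeta|\}}$. A positive measurable $w$ on $\Omega$ is of *dyadic bounded hyperbolic oscillation* if $|\log w(z)-\log w(\zeta)|\le L(1+\beta_{\mathcal{D}}(z,\zeta))$ for a.e. $z,\zeta\in\Omega$ and some $L\ge 0$; the smallest such $L$ is $L_w$. **Theorem.** Let $\mathcal{D}$ be a dyadic grid and let $\Omega=\bigcup_{I\in\mathcal{J}}T(I)$ for a nonempty $\mathcal{J}\subset\mathcal{D}$. If $w$ is a weight of dyadic bounded hyperbolic oscillation in $\Omega$ such that $w^q\in B_{1,\mathcal{D},\Omega}$ for some $q>1$, then there exists $W\in B_{1,\mathcal{D}}$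 of dyadic bounded hyperbolic oscillation in $\mathbb{D}$ such that $W(z)=w(z)$ for almost every $z\in\Omega$ and $$[W]_{B_{1,\mathcal{D}}}\le\frac{2q-1}{q-1}\,\max\{1,[w^q]_{B_{1,\mathcal{D},\Omega}}\}^{1/q}\,e^{3L_w},\qquad L_W\le\frac{\log\big(64[w^q]_{B_{1,\mathcal{D},\Omega}}\big)}{q}+3L_w.$$ Conversely, if $w$ coincides almost everywhere in $\Omega$ with some $W\in B_{1,\mathcal{D}}$ of dyadic bounded hyperbolic oscillation, then there exists $q>1$ such that $w^q\in B_{1,\mathcal{D},\Omega}$. -/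

import Mathlib

open MeasureTheory
open scoped ENNReal

noncomputable section

namespace DyadicBB

/-- The open unit disc. -/
def disc : Set ℂ := Metric.ball 0 1

/-- The unit circle. -/
def circle : Set ℂ := Metric.sphere 0 1

/-- Normalized area measure `dA` on the unit disc. -/
def area : Measure ℂ := (volume disc)⁻¹ • volume.restrict disc

/-- A half-open arc of the unit circle, which contains its right but not its left endpoint.
The whole circle is such an arc (`b = a + 2π`). -/
def IsArc (I : Set ℂ) : Prop :=
  ∃ a b : ℝ, a < b ∧ b ≤ a + 2 * Real.pi ∧
    I = (fun t : ℝ => Complex.exp (t * Complex.I)) '' Set.Ioc a b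

/-- Normalized arc length `|I|` of a subset of the unit circle (the circle has length `1`). -/
def arcLength (I : Set ℂ) : ℝ :=
  (volume {t : ℝ | t ∈ Set.Ioc (-Real.pi) Real.pi ∧ Complex.exp (t * Complex.I) ∈ I}).toReal
    / (2 * Real.pi)

/-- Dyadic grids of the unit circle. -/
structure IsDyadicGrid (D : Set (Set ℂ)) : Prop where
  isArc : ∀ I ∈ D, IsArc I
  circle_mem : circle ∈ D
  /-- All lengths are of the form `2⁻ⁿ`. -/
  length_dyadic : ∀ I ∈ D, ∃ n : ℕ, arcLength I = (1 / 2 : ℝ) ^ n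
  /-- The members of a given length form a partition of the circle. -/
  partition : ∀ I ∈ D, ∀ z ∈ circle, ∃! J, J ∈ D ∧ arcLength J = arcLength I ∧ z ∈ J
  /-- Every member is the union of two different members of the same length. -/
  split : ∀ I ∈ D, ∃ I₁ ∈ D, ∃ I₂ ∈ D, I₁ ≠ I₂ ∧ arcLength I₁ = arcLength I₂ ∧ I = I₁ ∪ I₂

/-- The Carleson square `S(I)`. -/
def carlesonSquare (I : Set ℂ) : Set ℂ :=
  {z | z ∈ disc ∧ z / (‖z‖ : ℂ) ∈ I ∧ 1 - ‖z‖ < arcLength I}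

/-- The top half `T(I)`. -/
def topHalf (I : Set ℂ) : Set ℂ :=
  {z | z ∈ disc ∧ 1 / 2 < (1 - ‖z‖) / arcLength I ∧ (1 - ‖z‖) / arcLength I ≤ 1 ∧
    z / (‖z‖ : ℂ) ∈ I}

/-- The restricted dyadic maximal operator `M_{D,Ω}`, with values in `[0, ∞]`. -/
def maximalOp (D : Set (Set ℂ)) (Ω : Set ℂ) (f : ℂ → ℝ) (z : ℂ) : ℝ≥0∞ :=
  ⨆ I ∈ D, ⨆ _ : z ∈ carlesonSquare I ∩ Ω,
    (∫⁻ ζ in carlesonSquare I ∩ Ω, ‖f ζ‖ₑ ∂area) / area (carlesonSquare I)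

/-- `C` is admissible in the `B₁` condition `M_{D,Ω} w ≤ C w` a.e. in `Ω`. -/
def B1Bound (D : Set (Set ℂ)) (Ω : Set ℂ) (w : ℂ → ℝ) (C : ℝ) : Prop :=
  0 < C ∧ ∀ᵐ z ∂(area.restrict Ω), maximalOp D Ω w z ≤ ENNReal.ofReal (C * w z)

/-- The class `B_{1,D,Ω}`. Only the values of `w` on `Ω` matter. -/
structure MemB1 (D : Set (Set ℂ)) (Ω : Set ℂ) (w : ℂ → ℝ) : Prop where
  integrable : IntegrableOn w Ω area
  nonneg : ∀ᵐ z ∂(area.restrict Ω), 0 ≤ w z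
  exists_bound : ∃ C : ℝ, B1Bound D Ω w C

/-- The constant `[w]_{B_{1,D,Ω}}`: the infimum of all admissible `C`. -/
def b1Const (D : Set (Set ℂ)) (Ω : Set ℂ) (w : ℂ → ℝ) : ℝ :=
  sInf {C : ℝ | B1Bound D Ω w C}

/-- The arc `I_z` of `D` with `z ∈ T(I_z)`; it is unique for `z ≠ 0` in the disc, so that the
union has a single member. -/
def arcOf (D : Set (Set ℂ)) (z : ℂ) : Set ℂ :=
  ⋃₀ {I | I ∈ D ∧ z ∈ topHalf I}

/-- The smallest arc of `D` that contains `I` and `J`. For nonempty `I` the members of `D` that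
contain `I` and `J` form a finite chain, so that the intersection is one of them. -/
def commonArc (D : Set (Set ℂ)) (I J : Set ℂ) : Set ℂ :=
  ⋂₀ {K | K ∈ D ∧ I ⊆ K ∧ J ⊆ K}

/-- The dyadic hyperbolic distance `β_D`. -/
def dyadicDist (D : Set (Set ℂ)) (z ζ : ℂ) : ℝ :=
  Real.logb 2 (arcLength (commonArc D (arcOf D z) (arcOf D ζ)) /
    min (arcLength (arcOf D z)) (arcLength (arcOf D ζ)))

/-- `L` is admissible in the condition of dyadic bounded hyperbolic oscillation. -/
def OscBound (D : Set (Set ℂ)) (Ω : Set ℂ) (w : ℂ → ℝ) (L : ℝ) : Prop :=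
  0 ≤ L ∧ ∀ᵐ z ∂(area.restrict Ω), ∀ᵐ ζ ∂(area.restrict Ω),
    |Real.log (w z) - Real.log (w ζ)| ≤ L * (1 + dyadicDist D z ζ)

/-- `w` is a (positive, measurable) weight of dyadic bounded hyperbolic oscillation in `Ω`. -/
structure IsDyadicBHO (D : Set (Set ℂ)) (Ω : Set ℂ) (w : ℂ → ℝ) : Prop where
  aemeasurable : AEMeasurable w (area.restrict Ω)
  pos : ∀ᵐ z ∂(area.restrict Ω), 0 < w z
  exists_bound : ∃ L : ℝ, OscBound D Ω w L

/-- The oscillation constant `L_w`: the smallest admissible `L`. -/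
def oscConst (D : Set (Set ℂ)) (Ω : Set ℂ) (w : ℂ → ℝ) : ℝ :=
  sInf {L : ℝ | OscBound D Ω w L}

end DyadicBB

end

/-! The extension is explicit. Put `u = w ^ q` and let `μ I` be the supremum of the averages of `u`
over `S(J) ∩ Ω`, normalized by the area of the full square `S(J)`, over all dyadic `J ⊇ I`. Up to a
null set this is the constant value on `T(I)` of the dyadic maximal function of `u`, continued to
the whole disc. The weight `W` equals `w` on `Ω` and `μ I ^ (1 / q)` on `T(I)` off `Ω`.

Three facts make this work. On `Ω`, the `B₁` condition gives `μ I ≤ C * w ^ q`, and bounded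
oscillation gives `w ^ q ≤ 4 * exp (L * q) * μ I`, because `w` is almost constant on `T(I)` and
`T(I)` fills at least a quarter of `S(I)`. Thus the two definitions of `W` are comparable. Next, a
root of a maximal function is a `B₁` weight, as in the theorem of Coifman and Rochberg: the average
of `μ ^ (1 / q)` over `S(I)` is at most `q / (q - 1) * μ I ^ (1 / q)`
(`lintegral_maxAverage_rpow_le`). With the Hölder bound for `w` on `Ω`
(`lintegral_le_maxAverage_rpow`) the total factor is `1 + q / (q - 1) = (2 * q - 1) / (q - 1)`.
Finally, passing to a half of an arc multiplies `μ` by at most 4, so `log μ` is Lipschitz for `β_D`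
(`abs_log_maxAverage_sub_le`), which controls the oscillation of `W`.

The converse is a reverse Hölder inequality (`exists_reverse_holder`). By `B₁` the top of each
square carries a fixed share `δ` of its mass, so the two halves together carry at most `1 - δ`.
Averages grow by at most 4 per generation, so for small `ε` the quantity mass times average to the
power `ε` still decreases geometrically, and `W ^ (1 + ε)` has controlled averages.

Both integral estimates are Bellman function arguments resting on `lintegral_le_of_supersolution`:
it suffices to find a function of arcs whose drop from an arc to its two halves pays for the
integral over the top. -/

noncomputable section

namespace DyadicBB

/-! ### Arcs and their lengths. -/

/-- The principal arguments of the points of `I`. -/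
def angles (I : Set ℂ) : Set ℝ :=
  {t : ℝ | t ∈ Set.Ioc (-Real.pi) Real.pi ∧ Complex.exp (t * Complex.I) ∈ I}

theorem arcLength_eq (I : Set ℂ) : arcLength I = (volume (angles I)).toReal / (2 * Real.pi) := rfl

theorem measurableSet_disc : MeasurableSet disc := Metric.isOpen_ball.measurableSet

/-- The parameter interval has length at most `2π` and is half-open, so the exponential is injective
on it, and injective continuous images of Borel sets are Borel. -/
theorem IsArc.measurableSet {I : Set ℂ} (h : IsArc I) : MeasurableSet I := by
  obtain ⟨a, b, -, hb, rfl⟩ := h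
  refine MeasurableSet.image_of_continuousOn_injOn measurableSet_Ioc (by fun_prop) ?_
  intro s hs t ht hst
  obtain ⟨n, hn⟩ := Complex.exp_eq_exp_iff_exists_int.1 hst
  have h1 : s = t + n * (2 * Real.pi) := by
    have := congrArg Complex.im hn
    simpa using this
  have h2 : |(n : ℝ)| < 1 := by
    rw [abs_lt]
    have := Real.pi_pos
    constructor <;> nlinarith [hs.1, hs.2, ht.1, ht.2]
  have h3 : n = 0 := by
    have : |n| < 1 := by exact_mod_cast h2
    exact Int.abs_lt_one_iff.1 this
  simpa [h3] using h1

theorem IsArc.nonempty {I : Set ℂ} (h : IsArc I) : I.Nonempty := by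
  obtain ⟨a, b, hab, -, rfl⟩ := h
  exact ⟨_, b, ⟨hab, le_rfl⟩, rfl⟩

theorem exp_mem_circle (t : ℝ) : Complex.exp (t * Complex.I) ∈ circle := by
  simp [circle, Complex.norm_exp_ofReal_mul_I]

theorem IsArc.subset_circle {I : Set ℂ} (h : IsArc I) : I ⊆ circle := by
  obtain ⟨a, b, -, -, rfl⟩ := h
  rintro _ ⟨t, -, rfl⟩
  exact exp_mem_circle t

theorem measurableSet_angles {I : Set ℂ} (h : MeasurableSet I) : MeasurableSet (angles I) :=
  measurableSet_Ioc.inter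
    ((by fun_prop : Measurable fun t : ℝ => Complex.exp (t * Complex.I)) h)

theorem volume_angles_ne_top (I : Set ℂ) : volume (angles I) ≠ ∞ :=
  ((measure_mono (fun _ ht => ht.1)).trans_lt (measure_Ioc_lt_top (a := -Real.pi) (b := Real.pi))).ne

theorem volume_angles (I : Set ℂ) :
    volume (angles I) = ENNReal.ofReal (2 * Real.pi * arcLength I) := by
  rw [arcLength_eq, mul_div_cancel₀ _ Real.two_pi_pos.ne', ENNReal.ofReal_toReal]
  exact volume_angles_ne_top I

theorem arcLength_union {I J : Set ℂ} (hJ : MeasurableSet J) (h : Disjoint I J) :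
    arcLength (I ∪ J) = arcLength I + arcLength J := by
  have h1 : angles (I ∪ J) = angles I ∪ angles J := by
    ext t; simp only [angles, Set.mem_ofPred_eq, Set.mem_union]; tauto
  have h2 : Disjoint (angles I) (angles J) :=
    Set.disjoint_left.2 fun t h1 h2 => Set.disjoint_left.1 h h1.2 h2.2
  rw [arcLength_eq, h1, measure_union h2 (measurableSet_angles hJ),
    ENNReal.toReal_add (volume_angles_ne_top I) (volume_angles_ne_top J), add_div]
  rfl

theorem arcLength_circle : arcLength circle = 1 := by
  have : angles circle = Set.Ioc (-Real.pi) Real.pi := by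
    ext t; simp [angles, exp_mem_circle t]
  have hpi := Real.pi_pos
  rw [arcLength_eq, this, Real.volume_Ioc, ENNReal.toReal_ofReal (by linarith)]
  field_simp; ring

/-! ### Combinatorics of dyadic grids. -/

namespace IsDyadicGrid

variable {D : Set (Set ℂ)}

theorem measurableSet (hD : IsDyadicGrid D) {I : Set ℂ} (hI : I ∈ D) : MeasurableSet I :=
  (hD.isArc I hI).measurableSet

theorem nonempty (hD : IsDyadicGrid D) {I : Set ℂ} (hI : I ∈ D) : I.Nonempty :=
  (hD.isArc I hI).nonempty

theorem subset_circle (hD : IsDyadicGrid D) {I : Set ℂ} (hI : I ∈ D) : I ⊆ circle :=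
  (hD.isArc I hI).subset_circle

theorem arcLength_pos (hD : IsDyadicGrid D) {I : Set ℂ} (hI : I ∈ D) : 0 < arcLength I := by
  obtain ⟨n, hn⟩ := hD.length_dyadic I hI
  rw [hn]; positivity

theorem arcLength_le_one (hD : IsDyadicGrid D) {I : Set ℂ} (hI : I ∈ D) : arcLength I ≤ 1 := by
  obtain ⟨n, hn⟩ := hD.length_dyadic I hI
  rw [hn]; exact pow_le_one₀ (by norm_num) (by norm_num)

theorem eq_of_mem (hD : IsDyadicGrid D) {I J : Set ℂ} (hI : I ∈ D) (hJ : J ∈ D)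
    (h : arcLength I = arcLength J) {x : ℂ} (hxI : x ∈ I) (hxJ : x ∈ J) : I = J :=
  (hD.partition I hI x (hD.subset_circle hI hxI)).unique ⟨hI, rfl, hxI⟩ ⟨hJ, h.symm, hxJ⟩

/-- `I₁` and `I₂` are the two halves of `I` in the grid. -/
structure IsChildren (D : Set (Set ℂ)) (I I₁ I₂ : Set ℂ) : Prop where
  mem : I ∈ D
  mem₁ : I₁ ∈ D
  mem₂ : I₂ ∈ D
  disjoint : Disjoint I₁ I₂
  length₁ : arcLength I₁ = arcLength I / 2
  length₂ : arcLength I₂ = arcLength I / 2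
  union : I = I₁ ∪ I₂

theorem exists_children (hD : IsDyadicGrid D) {I : Set ℂ} (hI : I ∈ D) :
    ∃ I₁ I₂, IsChildren D I I₁ I₂ := by
  obtain ⟨I₁, h₁, I₂, h₂, hne, hl, hu⟩ := hD.split I hI
  have hd : Disjoint I₁ I₂ :=
    Set.disjoint_left.2 fun x hx₁ hx₂ => hne (hD.eq_of_mem h₁ h₂ hl hx₁ hx₂)
  have := arcLength_union (hD.measurableSet h₂) hd
  rw [← hu] at this
  exact ⟨I₁, I₂, hI, h₁, h₂, hd, by linarith, by linarith, hu⟩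

theorem exists_sub (hD : IsDyadicGrid D) {J : Set ℂ} (hJ : J ∈ D) {x : ℂ} (hx : x ∈ J) (k : ℕ) :
    ∃ I ∈ D, x ∈ I ∧ I ⊆ J ∧ arcLength I = arcLength J * (1 / 2 : ℝ) ^ k := by
  induction k with
  | zero => exact ⟨J, hJ, hx, le_rfl, by simp⟩
  | succ k ih =>
    obtain ⟨I, hI, hxI, hIJ, hl⟩ := ih
    obtain ⟨I₁, I₂, h⟩ := hD.exists_children hI
    have hx' := hxI
    rw [h.union] at hx' hIJ
    rcases hx' with hx' | hx'
    · exact ⟨I₁, h.mem₁, hx', Set.subset_union_left.trans hIJ, by rw [h.length₁, hl]; ring⟩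
    · exact ⟨I₂, h.mem₂, hx', Set.subset_union_right.trans hIJ, by rw [h.length₂, hl]; ring⟩

theorem half_pow_le {m n : ℕ} (h : (1 / 2 : ℝ) ^ m ≤ (1 / 2 : ℝ) ^ n) : n ≤ m :=
  (pow_le_pow_iff_right_of_lt_one₀ (by norm_num) (by norm_num)).1 h

/-- Dyadic arcs are nested or disjoint. -/
theorem subset_of_mem (hD : IsDyadicGrid D) {I J : Set ℂ} (hI : I ∈ D) (hJ : J ∈ D)
    (h : arcLength I ≤ arcLength J) {x : ℂ} (hxI : x ∈ I) (hxJ : x ∈ J) : I ⊆ J := by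
  obtain ⟨m, hm⟩ := hD.length_dyadic I hI
  obtain ⟨n, hn⟩ := hD.length_dyadic J hJ
  rw [hm, hn] at h
  -- The arc through `x` lying `k` generations below `J` has the length of `I`, hence is `I`.
  obtain ⟨k, rfl⟩ := Nat.exists_eq_add_of_le (half_pow_le h)
  obtain ⟨K, hK, hxK, hKJ, hl⟩ := hD.exists_sub hJ hxJ k
  rwa [hD.eq_of_mem hI hK (by rw [hm, hl, hn, pow_add]) hxI hxK]

theorem arcLength_le_of_subset (hD : IsDyadicGrid D) {I J : Set ℂ} (hI : I ∈ D) (hJ : J ∈ D)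
    (h : I ⊆ J) : arcLength I ≤ arcLength J := by
  by_contra! hlt
  obtain ⟨x, hx⟩ := hD.nonempty hI
  have := hD.subset_of_mem hJ hI hlt.le (h hx) hx
  rw [h.antisymm this] at hlt
  exact hlt.false

theorem double_le (hD : IsDyadicGrid D) {I J : Set ℂ} (hI : I ∈ D) (hJ : J ∈ D)
    (h : arcLength I < arcLength J) : 2 * arcLength I ≤ arcLength J := by
  obtain ⟨m, hm⟩ := hD.length_dyadic I hI
  obtain ⟨n, hn⟩ := hD.length_dyadic J hJ
  have hnm : n < m := by
    by_contra! hle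
    rw [hm, hn] at h
    exact absurd (pow_le_pow_of_le_one (by norm_num) (by norm_num) hle) (not_le.2 h)
  have : (1 / 2 : ℝ) ^ m ≤ (1 / 2 : ℝ) ^ (n + 1) :=
    pow_le_pow_of_le_one (by norm_num) (by norm_num) hnm
  rw [hm, hn]
  rw [pow_succ] at this
  linarith

theorem eq_or_subset_of_children (hD : IsDyadicGrid D) {I J K : Set ℂ} (hI : I ∈ D) (hK : K ∈ D)
    (hKI : K ⊆ I) (hl : arcLength K = arcLength I / 2) (hJ : J ∈ D) (h : K ⊆ J) :
    J = K ∨ I ⊆ J := by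
  obtain ⟨x, hx⟩ := hD.nonempty hK
  rcases (hD.arcLength_le_of_subset hK hJ h).eq_or_lt with he | hlt
  · exact Or.inl (hD.eq_of_mem hJ hK he.symm (h hx) hx)
  · have := hD.double_le hK hJ hlt
    exact Or.inr (hD.subset_of_mem hI hJ (by linarith) (hKI hx) (h hx))

theorem exists_arc (hD : IsDyadicGrid D) {x : ℂ} (hx : x ∈ circle) (n : ℕ) :
    ∃ I ∈ D, x ∈ I ∧ arcLength I = (1 / 2 : ℝ) ^ n := by
  obtain ⟨I, hI, hxI, -, hl⟩ := hD.exists_sub hD.circle_mem hx n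
  exact ⟨I, hI, hxI, by rw [hl, arcLength_circle, one_mul]⟩

/-- Each level is countable by induction: every arc of level `n + 1` is a half of an arc of level
`n`, and halves are unique. Countability is needed for the measurability of `Ω` and of functions of
`arcOf`. -/
theorem countable (hD : IsDyadicGrid D) : D.Countable := by
  have hlev : ∀ n : ℕ, {I | I ∈ D ∧ arcLength I = (1 / 2 : ℝ) ^ n}.Countable := by
    intro n
    induction n with
    | zero =>
      refine (Set.countable_singleton circle).mono ?_
      rintro I ⟨hI, hl⟩
      obtain ⟨x, hx⟩ := hD.nonempty hI
      exact hD.eq_of_mem hI hD.circle_mem (by rw [hl, arcLength_circle, pow_zero]) hx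
        (hD.subset_circle hI hx)
    | succ n ih =>
      have hch : ∀ I ∈ {I | I ∈ D ∧ arcLength I = (1 / 2 : ℝ) ^ n},
          ({K | ∃ I₁ I₂, IsChildren D I I₁ I₂ ∧ (K = I₁ ∨ K = I₂)} : Set (Set ℂ)).Countable := by
        intro I hI
        obtain ⟨I₁, I₂, h⟩ := hD.exists_children hI.1
        refine (Set.toFinite {I₁, I₂}).countable.mono ?_
        have key : ∀ K, K ∈ D → K ⊆ I → arcLength K = arcLength I / 2 → K = I₁ ∨ K = I₂ := by
          intro K hK hKI hl
          obtain ⟨x, hx⟩ := hD.nonempty hK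
          have hxI := hKI hx
          rw [h.union] at hxI
          rcases hxI with hx' | hx'
          · exact Or.inl (hD.eq_of_mem hK h.mem₁ (by rw [hl, h.length₁]) hx hx')
          · exact Or.inr (hD.eq_of_mem hK h.mem₂ (by rw [hl, h.length₂]) hx hx')
        rintro K ⟨J₁, J₂, hc, rfl | rfl⟩
        · exact key _ hc.mem₁ (by rw [hc.union]; exact Set.subset_union_left) hc.length₁
        · exact key _ hc.mem₂ (by rw [hc.union]; exact Set.subset_union_right) hc.length₂
      refine (ih.biUnion hch).mono ?_
      rintro K ⟨hK, hl⟩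
      obtain ⟨x, hx⟩ := hD.nonempty hK
      obtain ⟨I, hI, hxI, hlI⟩ := hD.exists_arc (hD.subset_circle hK hx) n
      obtain ⟨I₁, I₂, h⟩ := hD.exists_children hI
      refine Set.mem_biUnion (x := I) ⟨hI, hlI⟩ ⟨I₁, I₂, h, ?_⟩
      have hxI' := hxI
      rw [h.union] at hxI'
      rcases hxI' with hx' | hx'
      · exact Or.inl (hD.eq_of_mem hK h.mem₁ (by rw [hl, h.length₁, hlI, pow_succ]; ring) hx hx')
      · exact Or.inr (hD.eq_of_mem hK h.mem₂ (by rw [hl, h.length₂, hlI, pow_succ]; ring) hx hx')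
  refine (Set.countable_iUnion hlev).mono fun I hI => ?_
  obtain ⟨n, hn⟩ := hD.length_dyadic I hI
  exact Set.mem_iUnion.2 ⟨n, hI, hn⟩

/-- The smallest common ancestor of two dyadic arcs is `commonArc`. -/
theorem commonArc_mem (hD : IsDyadicGrid D) {I J : Set ℂ} (hI : I ∈ D) (hJ : J ∈ D) :
    commonArc D I J ∈ D ∧ I ⊆ commonArc D I J ∧ J ⊆ commonArc D I J := by
  classical
  obtain ⟨x, hx⟩ := hD.nonempty hI
  obtain ⟨m, hm⟩ := hD.length_dyadic I hI
  let p : ℕ → Prop := fun n => ∃ K ∈ D, I ⊆ K ∧ J ⊆ K ∧ arcLength K = (1 / 2 : ℝ) ^ n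
  have hbound : ∀ n, p n → n ≤ m := by
    rintro n ⟨K, hK, hIK, -, hn⟩
    refine half_pow_le ?_
    rw [← hm, ← hn]
    exact hD.arcLength_le_of_subset hI hK hIK
  have h0 : p 0 := ⟨circle, hD.circle_mem, hD.subset_circle hI, hD.subset_circle hJ,
    by rw [arcLength_circle, pow_zero]⟩
  -- Common ancestors have level at most that of `I`, so there is a deepest one; by nestedness it
  -- lies in all the others.
  obtain ⟨P, hP, hIP, hJP, hl⟩ : p (Nat.findGreatest p m) := Nat.findGreatest_spec (Nat.zero_le _) h0
  have heq : commonArc D I J = P := by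
    refine (Set.sInter_subset_of_mem (show P ∈ {K | K ∈ D ∧ I ⊆ K ∧ J ⊆ K} from ⟨hP, hIP, hJP⟩)).antisymm ?_
    rintro y hy K ⟨hK, hIK, hJK⟩
    obtain ⟨n, hn⟩ := hD.length_dyadic K hK
    have hpn : p n := ⟨K, hK, hIK, hJK, hn⟩
    refine hD.subset_of_mem hP hK ?_ (hIP hx) (hIK hx) hy
    rw [hl, hn]
    exact pow_le_pow_of_le_one (by norm_num) (by norm_num)
      (Nat.le_findGreatest (hbound n hpn) hpn)
  rw [heq]
  exact ⟨hP, hIP, hJP⟩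

theorem commonArc_self (hD : IsDyadicGrid D) {I : Set ℂ} (hI : I ∈ D) : commonArc D I I = I :=
  (Set.sInter_subset_of_mem (show I ∈ {K | K ∈ D ∧ I ⊆ K ∧ I ⊆ K} from ⟨hI, le_rfl, le_rfl⟩)).antisymm (hD.commonArc_mem hI hI).2.1

/-- The heights allowed in `T(I)` fill `(|I| / 2, |I|]`, and these intervals are disjoint for
different dyadic lengths. -/
theorem eq_of_mem_topHalf (hD : IsDyadicGrid D) {I J : Set ℂ} (hI : I ∈ D) (hJ : J ∈ D) {z : ℂ}
    (hzI : z ∈ topHalf I) (hzJ : z ∈ topHalf J) : I = J := by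
  have hpI := hD.arcLength_pos hI
  have hpJ := hD.arcLength_pos hJ
  obtain ⟨-, h1, h2, h3⟩ := hzI
  obtain ⟨-, h4, h5, h6⟩ := hzJ
  rw [lt_div_iff₀ ‹_›] at h1 h4
  rw [div_le_iff₀ ‹_›] at h2 h5
  refine hD.eq_of_mem hI hJ ?_ h3 h6
  rcases lt_trichotomy (arcLength I) (arcLength J) with h | h | h
  · have := hD.double_le hI hJ h; linarith
  · exact h
  · have := hD.double_le hJ hI h; linarith

theorem arcOf_eq (hD : IsDyadicGrid D) {I : Set ℂ} (hI : I ∈ D) {z : ℂ} (hz : z ∈ topHalf I) :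
    arcOf D z = I := by
  have : {J | J ∈ D ∧ z ∈ topHalf J} = {I} := by
    ext J
    constructor
    · rintro ⟨hJ, hzJ⟩; exact hD.eq_of_mem_topHalf hJ hI hzJ hz
    · rintro rfl; exact ⟨hI, hz⟩
  rw [arcOf, this, Set.sUnion_singleton]

theorem dyadicDist_self (hD : IsDyadicGrid D) {I : Set ℂ} (hI : I ∈ D) {z ζ : ℂ}
    (hz : z ∈ topHalf I) (hζ : ζ ∈ topHalf I) : dyadicDist D z ζ = 0 := by
  rw [dyadicDist, hD.arcOf_eq hI hz, hD.arcOf_eq hI hζ, hD.commonArc_self hI, min_self,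
    div_self (hD.arcLength_pos hI).ne', Real.logb_one]

theorem dyadicDist_spec (hD : IsDyadicGrid D) {I J : Set ℂ} (hI : I ∈ D) (hJ : J ∈ D) {z ζ : ℂ}
    (hz : z ∈ topHalf I) (hζ : ζ ∈ topHalf J) :
    ∃ P ∈ D, I ⊆ P ∧ J ⊆ P ∧ 0 ≤ dyadicDist D z ζ ∧
      Real.logb 2 (arcLength P / arcLength I) ≤ dyadicDist D z ζ ∧
      Real.logb 2 (arcLength P / arcLength J) ≤ dyadicDist D z ζ := by
  obtain ⟨hP, hIP, hJP⟩ := hD.commonArc_mem hI hJ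
  have hpI := hD.arcLength_pos hI
  have hpJ := hD.arcLength_pos hJ
  have hpP := hD.arcLength_pos hP
  have h1 : Real.logb 2 (arcLength (commonArc D I J) / arcLength I) ≤ dyadicDist D z ζ := by
    rw [dyadicDist, hD.arcOf_eq hI hz, hD.arcOf_eq hJ hζ]
    refine Real.logb_le_logb_of_le (by norm_num) (by positivity) ?_
    exact div_le_div_of_nonneg_left hpP.le (lt_min hpI hpJ) (min_le_left _ _)
  have h2 : Real.logb 2 (arcLength (commonArc D I J) / arcLength J) ≤ dyadicDist D z ζ := by
    rw [dyadicDist, hD.arcOf_eq hI hz, hD.arcOf_eq hJ hζ]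
    refine Real.logb_le_logb_of_le (by norm_num) (by positivity) ?_
    exact div_le_div_of_nonneg_left hpP.le (lt_min hpI hpJ) (min_le_right _ _)
  refine ⟨_, hP, hIP, hJP, le_trans (Real.logb_nonneg (by norm_num) ?_) h1, h1, h2⟩
  rw [one_le_div hpI]
  exact hD.arcLength_le_of_subset hI hP hIP

end IsDyadicGrid

/-! ### Areas of polar sectors. -/

theorem measurableSet_polarSector {I : Set ℂ} {R : Set ℝ} (hI : MeasurableSet I)
    (hR : MeasurableSet R) : MeasurableSet {z : ℂ | z / (‖z‖ : ℂ) ∈ I ∧ ‖z‖ ∈ R} := by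
  refine MeasurableSet.inter ?_ (measurable_norm hR)
  exact (by fun_prop : Measurable fun z : ℂ => z / (‖z‖ : ℂ)) hI

theorem volume_polarSector {I : Set ℂ} {R : Set ℝ} (hI : MeasurableSet I)
    (hR : MeasurableSet R) (hR0 : R ⊆ Set.Ioi 0) :
    volume {z : ℂ | z / (‖z‖ : ℂ) ∈ I ∧ ‖z‖ ∈ R} =
      (∫⁻ r in R, ENNReal.ofReal r) * volume (angles I) := by
  have hs := measurableSet_polarSector hI hR
  -- Polar coordinates omit the negative real axis, that is the angle `π`.
  have hA : volume (angles I) = volume (angles I ∩ Set.Ioo (-Real.pi) Real.pi) := by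
    refine measure_congr ?_
    have h1 : angles I = angles I ∩ Set.Ioc (-Real.pi) Real.pi :=
      (Set.inter_eq_left.2 fun t ht => ht.1).symm
    conv_lhs => rw [h1]
    exact (ae_eq_refl _).inter Ioo_ae_eq_Ioc.symm
  rw [hA, ← lintegral_indicator_one hs, ← Complex.lintegral_comp_polarCoord_symm]
  have h2 : ∀ p ∈ polarCoord.target, ENNReal.ofReal p.1 •
      Set.indicator {z : ℂ | z / (‖z‖ : ℂ) ∈ I ∧ ‖z‖ ∈ R} (1 : ℂ → ℝ≥0∞)
        (Complex.polarCoord.symm p) =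
      Set.indicator R (fun r => ENNReal.ofReal r) p.1 *
        Set.indicator (angles I ∩ Set.Ioo (-Real.pi) Real.pi) 1 p.2 := by
    rintro ⟨r, t⟩ ⟨hr, ht⟩
    simp only [Set.mem_Ioi] at hr
    have hz : Complex.polarCoord.symm (r, t) = r * Complex.exp (t * Complex.I) := by
      rw [Complex.polarCoord_symm_apply, Complex.exp_mul_I, Complex.ofReal_cos, Complex.ofReal_sin]
    have hn : ‖(r : ℂ) * Complex.exp (t * Complex.I)‖ = r := by
      rw [norm_mul, Complex.norm_exp_ofReal_mul_I, mul_one, Complex.norm_real,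
        Real.norm_of_nonneg hr.le]
    have hq : (r : ℂ) * Complex.exp (t * Complex.I) / (r : ℂ) = Complex.exp (t * Complex.I) := by
      have : (r : ℂ) ≠ 0 := by exact_mod_cast hr.ne'
      field_simp
    have hmem : t ∈ angles I ∩ Set.Ioo (-Real.pi) Real.pi ↔ Complex.exp (t * Complex.I) ∈ I :=
      ⟨fun h => h.1.2, fun h => ⟨⟨⟨ht.1, ht.2.le⟩, h⟩, ht⟩⟩
    have habs : |r| = r := abs_of_pos hr
    rw [hz]
    by_cases h3 : r ∈ R <;> by_cases h4 : Complex.exp (t * Complex.I) ∈ I <;>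
      simp [Set.indicator, habs, hq, h3, h4, hmem]
  rw [setLIntegral_congr_fun polarCoord.open_target.measurableSet h2, polarCoord_target,
    Measure.volume_eq_prod, ← Measure.prod_restrict,
    lintegral_prod_mul ((by fun_prop : Measurable fun r : ℝ => ENNReal.ofReal r).indicator
      hR).aemeasurable ((measurable_one.indicator
        ((measurableSet_angles hI).inter measurableSet_Ioo)).aemeasurable)]
  congr 1
  · rw [lintegral_indicator hR, Measure.restrict_restrict hR, Set.inter_eq_left.2 hR0]
  · rw [lintegral_indicator_one ((measurableSet_angles hI).inter measurableSet_Ioo),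
      Measure.restrict_apply ((measurableSet_angles hI).inter measurableSet_Ioo)]
    congr 1
    rw [Set.inter_assoc, Set.inter_self]

theorem lintegral_Ioo_ofReal {a b : ℝ} (ha : 0 ≤ a) (hab : a ≤ b) :
    ∫⁻ r in Set.Ioo a b, ENNReal.ofReal r = ENNReal.ofReal ((b ^ 2 - a ^ 2) / 2) := by
  rw [setLIntegral_congr Ioo_ae_eq_Ioc, ← ofReal_integral_eq_lintegral_ofReal,
    ← intervalIntegral.integral_of_le hab, integral_id]
  · exact (intervalIntegrable_iff_integrableOn_Ioc_of_le hab).1 intervalIntegral.intervalIntegrable_id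
  · filter_upwards [ae_restrict_mem measurableSet_Ioc] with r hr using ha.trans hr.1.le

theorem volume_disc : volume disc = ENNReal.ofReal Real.pi := by
  rw [disc, Complex.volume_ball]
  rw [ENNReal.ofReal_one, one_pow, one_mul, ← NNReal.coe_real_pi, ENNReal.ofReal_coe_nnreal]

theorem area_apply {s : Set ℂ} (hs : MeasurableSet s) (h : s ⊆ disc) :
    area s = (volume disc)⁻¹ * volume s := by
  rw [area, Measure.smul_apply, Measure.restrict_apply hs, Set.inter_eq_left.2 h, smul_eq_mul]

instance : IsFiniteMeasure area := by
  constructor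
  rw [area, Measure.smul_apply, Measure.restrict_apply MeasurableSet.univ, Set.univ_inter,
    smul_eq_mul]
  refine ENNReal.mul_lt_top ?_ ?_
  · rw [volume_disc, ENNReal.inv_lt_top]; exact ENNReal.ofReal_pos.2 Real.pi_pos
  · rw [volume_disc]; exact ENNReal.ofReal_lt_top

theorem area_restrict_disc : area.restrict disc = area := by
  rw [area, Measure.restrict_smul, Measure.restrict_restrict measurableSet_disc, Set.inter_self]

theorem area_absolutelyContinuous : area ≪ volume :=
  (Measure.smul_absolutelyContinuous).trans Measure.absolutelyContinuous_restrict

/-- The radii need only form an interval up to a null set, so that open, half-open and punctured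
ranges are covered together. -/
theorem area_polarSector {I : Set ℂ} {R : Set ℝ} (hI : MeasurableSet I) (hR : MeasurableSet R)
    {a b : ℝ} (ha : 0 ≤ a) (hab : a ≤ b) (hRI : R ⊆ Set.Ioo 0 1)
    (hae : R =ᵐ[volume] Set.Ioo a b) :
    area {z : ℂ | z / (‖z‖ : ℂ) ∈ I ∧ ‖z‖ ∈ R} =
      ENNReal.ofReal (arcLength I * (b ^ 2 - a ^ 2)) := by
  have hsub : {z : ℂ | z / (‖z‖ : ℂ) ∈ I ∧ ‖z‖ ∈ R} ⊆ disc := by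
    rintro z ⟨-, hz⟩
    simpa [disc] using (hRI hz).2
  have hl : 0 ≤ arcLength I := div_nonneg ENNReal.toReal_nonneg Real.two_pi_pos.le
  rw [area_apply (measurableSet_polarSector hI hR) hsub, volume_polarSector hI hR
    (fun r hr => (hRI hr).1), setLIntegral_congr hae, lintegral_Ioo_ofReal ha hab, volume_angles,
    volume_disc, ← ENNReal.ofReal_inv_of_pos Real.pi_pos,
    ← ENNReal.ofReal_mul (by nlinarith), ← ENNReal.ofReal_mul (by positivity)]
  congr 1
  have := Real.pi_pos.ne'
  field_simp

/-! ### Carleson squares and their tops. -/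

/-- The upper half of the Carleson square `S(I)`, that is `S(I)` without `S` of its children.
It differs from `T(I)` by a null set. -/
def squareTop (I : Set ℂ) : Set ℂ :=
  {z | z ∈ disc ∧ z / (‖z‖ : ℂ) ∈ I ∧ arcLength I / 2 ≤ 1 - ‖z‖ ∧ 1 - ‖z‖ < arcLength I}

/-- The area of `S(I)`, as a function of the length of `I`. -/
def squareArea (I : Set ℂ) : ℝ := arcLength I ^ 2 * (2 - arcLength I)

/-- The area of `T(I)`, as a function of the length of `I`. -/
def topArea (I : Set ℂ) : ℝ := arcLength I ^ 2 * (1 - 3 / 4 * arcLength I)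

theorem squareTop_subset (I : Set ℂ) : squareTop I ⊆ carlesonSquare I :=
  fun _ hz => ⟨hz.1, hz.2.1, hz.2.2.2⟩

/-- Since `0 / 0 = 0` is not on the circle, the origin lies in no Carleson square or top half of a
dyadic arc. -/
theorem norm_pos_of_div_mem_circle {z : ℂ} (h : z / (‖z‖ : ℂ) ∈ circle) : 0 < ‖z‖ := by
  rw [norm_pos_iff]
  rintro rfl
  simp [circle] at h

namespace IsDyadicGrid

variable {D : Set (Set ℂ)} {I : Set ℂ}

theorem _root_.DyadicBB.carlesonSquare_eq (I : Set ℂ) :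
    carlesonSquare I = {z : ℂ | z / (‖z‖ : ℂ) ∈ I ∧ ‖z‖ ∈ Set.Ioo (1 - arcLength I) 1} := by
  ext z
  simp only [carlesonSquare, disc, Set.mem_ofPred_eq, mem_ball_zero_iff, Set.mem_Ioo]
  constructor
  · rintro ⟨h1, h2, h3⟩; exact ⟨h2, by linarith, h1⟩
  · rintro ⟨h2, h3, h1⟩; exact ⟨h1, h2, by linarith⟩

theorem squareTop_eq (hD : IsDyadicGrid D) (hI : I ∈ D) :
    squareTop I =
      {z : ℂ | z / (‖z‖ : ℂ) ∈ I ∧ ‖z‖ ∈ Set.Ioc (1 - arcLength I) (1 - arcLength I / 2)} := by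
  have := hD.arcLength_pos hI
  ext z
  simp only [squareTop, disc, Set.mem_ofPred_eq, mem_ball_zero_iff, Set.mem_Ioc]
  constructor
  · rintro ⟨h1, h2, h3, h4⟩; exact ⟨h2, by linarith, by linarith⟩
  · rintro ⟨h2, h3, h1⟩; exact ⟨by linarith, h2, by linarith, by linarith⟩

theorem topHalf_eq (hD : IsDyadicGrid D) (hI : I ∈ D) :
    topHalf I = {z : ℂ | z / (‖z‖ : ℂ) ∈ I ∧
      ‖z‖ ∈ Set.Ico (1 - arcLength I) (1 - arcLength I / 2) ∩ Set.Ioi 0} := by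
  have := hD.arcLength_pos hI
  ext z
  simp only [topHalf, disc, Set.mem_ofPred_eq, mem_ball_zero_iff, Set.mem_inter_iff, Set.mem_Ico,
    Set.mem_Ioi]
  rw [lt_div_iff₀ this, div_le_iff₀ this]
  constructor
  · rintro ⟨h1, h2, h3, h4⟩
    exact ⟨h4, ⟨by linarith, by linarith⟩, norm_pos_of_div_mem_circle (hD.subset_circle hI h4)⟩
  · rintro ⟨h2, ⟨h3, h1⟩, -⟩; exact ⟨by linarith, by linarith, by linarith, h2⟩

theorem measurableSet_carlesonSquare (hD : IsDyadicGrid D) (hI : I ∈ D) :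
    MeasurableSet (carlesonSquare I) := by
  rw [carlesonSquare_eq I]
  exact measurableSet_polarSector (hD.measurableSet hI) measurableSet_Ioo

theorem measurableSet_squareTop (hD : IsDyadicGrid D) (hI : I ∈ D) :
    MeasurableSet (squareTop I) := by
  rw [hD.squareTop_eq hI]
  exact measurableSet_polarSector (hD.measurableSet hI) measurableSet_Ioc

theorem measurableSet_topHalf (hD : IsDyadicGrid D) (hI : I ∈ D) :
    MeasurableSet (topHalf I) := by
  rw [hD.topHalf_eq hI]
  exact measurableSet_polarSector (hD.measurableSet hI) (measurableSet_Ico.inter measurableSet_Ioi)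

theorem area_carlesonSquare (hD : IsDyadicGrid D) (hI : I ∈ D) :
    area (carlesonSquare I) = ENNReal.ofReal (squareArea I) := by
  have h0 := hD.arcLength_pos hI
  have h1 := hD.arcLength_le_one hI
  rw [carlesonSquare_eq I, area_polarSector (hD.measurableSet hI) measurableSet_Ioo
    (a := 1 - arcLength I) (b := 1) (by linarith) (by linarith)
    (Set.Ioo_subset_Ioo_left (by linarith)) (ae_eq_refl _), squareArea]
  congr 1; ring

theorem area_squareTop (hD : IsDyadicGrid D) (hI : I ∈ D) :
    area (squareTop I) = ENNReal.ofReal (topArea I) := by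
  have h0 := hD.arcLength_pos hI
  have h1 := hD.arcLength_le_one hI
  rw [hD.squareTop_eq hI, area_polarSector (hD.measurableSet hI) measurableSet_Ioc
    (a := 1 - arcLength I) (b := 1 - arcLength I / 2) (by linarith) (by linarith)
    (fun r hr => ⟨by linarith [hr.1], by linarith [hr.2]⟩) Ioo_ae_eq_Ioc.symm, topArea]
  congr 1; ring

theorem area_topHalf (hD : IsDyadicGrid D) (hI : I ∈ D) :
    area (topHalf I) = ENNReal.ofReal (topArea I) := by
  have h0 := hD.arcLength_pos hI
  have h1 := hD.arcLength_le_one hI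
  rw [hD.topHalf_eq hI, area_polarSector (hD.measurableSet hI)
    (measurableSet_Ico.inter measurableSet_Ioi)
    (a := 1 - arcLength I) (b := 1 - arcLength I / 2) (by linarith) (by linarith)
    (fun r hr => ⟨hr.2, by linarith [hr.1.2]⟩) ?_, topArea]
  · congr 1; ring
  · have : (Set.Ico (1 - arcLength I) (1 - arcLength I / 2) ∩ Set.Ioi 0 : Set ℝ) =ᵐ[volume]
        (Set.Ico (1 - arcLength I) (1 - arcLength I / 2) ∩ Set.Ici 0 : Set ℝ) :=
      (ae_eq_refl _).inter Ioi_ae_eq_Ici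
    rw [Set.inter_eq_left.2 (show Set.Ico (1 - arcLength I) (1 - arcLength I / 2) ⊆ Set.Ici 0 from
      fun r hr => by simp only [Set.mem_Ici]; linarith [hr.1])] at this
    exact this.trans Ioo_ae_eq_Ico.symm

theorem topArea_pos (hD : IsDyadicGrid D) (hI : I ∈ D) : 0 < topArea I := by
  have h0 := hD.arcLength_pos hI
  have h1 := hD.arcLength_le_one hI
  exact mul_pos (by positivity) (by linarith)

theorem squareArea_pos (hD : IsDyadicGrid D) (hI : I ∈ D) : 0 < squareArea I := by
  have h0 := hD.arcLength_pos hI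
  have h1 := hD.arcLength_le_one hI
  exact mul_pos (by positivity) (by linarith)

/-- Equivalent to `2 - ℓ ≤ 4 - 3 * ℓ` with `ℓ ≤ 1`; equality holds for the full circle. This is one
of the two sources of the factors 4 below. -/
theorem squareArea_le (hD : IsDyadicGrid D) (hI : I ∈ D) : squareArea I ≤ 4 * topArea I := by
  have h0 := hD.arcLength_pos hI
  have h1 := hD.arcLength_le_one hI
  rw [squareArea, topArea]
  nlinarith [mul_pos h0 h0]

theorem squareArea_le_of_subset (hD : IsDyadicGrid D) (hI : I ∈ D) {P : Set ℂ} (hP : P ∈ D)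
    (h : I ⊆ P) : squareArea P ≤ (arcLength P / arcLength I) ^ 2 * squareArea I := by
  have h0 := hD.arcLength_pos hI
  have h1 := hD.arcLength_le_of_subset hI hP h
  have : (arcLength P / arcLength I) ^ 2 * squareArea I = arcLength P ^ 2 * (2 - arcLength I) := by
    rw [squareArea]; field_simp
  rw [this, squareArea]
  gcongr

theorem squareArea_children {I₁ I₂ : Set ℂ} (h : IsChildren D I I₁ I₂) :
    topArea I + squareArea I₁ + squareArea I₂ = squareArea I := by
  simp only [topArea, squareArea, h.length₁, h.length₂]; ring

theorem carlesonSquare_children {I₁ I₂ : Set ℂ} (h : IsChildren D I I₁ I₂) :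
    carlesonSquare I ⊆ squareTop I ∪ (carlesonSquare I₁ ∪ carlesonSquare I₂) := by
  rintro z ⟨h1, h2, h3⟩
  by_cases h4 : arcLength I / 2 ≤ 1 - ‖z‖
  · exact Or.inl ⟨h1, h2, h4, h3⟩
  · rw [h.union] at h2
    push Not at h4
    rcases h2 with h2 | h2
    · exact Or.inr (Or.inl ⟨h1, h2, by rwa [h.length₁]⟩)
    · exact Or.inr (Or.inr ⟨h1, h2, by rwa [h.length₂]⟩)

theorem carlesonSquare_subset (hD : IsDyadicGrid D) (hI : I ∈ D) {P : Set ℂ} (hP : P ∈ D)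
    (h : I ⊆ P) : carlesonSquare I ⊆ carlesonSquare P :=
  fun _ hz => ⟨hz.1, h hz.2.1, hz.2.2.trans_le (hD.arcLength_le_of_subset hI hP h)⟩

/-! ### Induction over Carleson squares. -/

/-- If the estimate for `Φ` improves by the mass of `g` in passing to the children, then `Φ`
dominates the integrals of `g` over the Carleson squares. -/
theorem lintegral_le_of_supersolution (hD : IsDyadicGrid D) {g : ℂ → ℝ≥0∞} {Φ : Set ℂ → ℝ≥0∞}
    (h : ∀ I I₁ I₂, IsChildren D I I₁ I₂ → ∫⁻ z in squareTop I, g z ∂area + (Φ I₁ + Φ I₂) ≤ Φ I)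
    (hI : I ∈ D) : ∫⁻ z in carlesonSquare I, g z ∂area ≤ Φ I := by
  let R : ℕ → Set ℂ := fun N => {z | (1 / 2 : ℝ) ^ N ≤ 1 - ‖z‖}
  have hR : ∀ N z, z ∈ R N ↔ (1 / 2 : ℝ) ^ N ≤ 1 - ‖z‖ := fun _ _ => Iff.rfl
  -- Cutting off at height `2⁻ᴺ` makes the induction finite. Here `k` counts the generations from
  -- that height up to `I`; for `k = 0` the truncated square is empty because squares are open at
  -- the top.
  have key : ∀ N k : ℕ, ∀ I ∈ D, (1 / 2 : ℝ) ^ N * 2 ^ k = arcLength I →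
      ∫⁻ z in carlesonSquare I ∩ R N, g z ∂area ≤ Φ I := by
    intro N k
    induction k with
    | zero =>
      intro I hI hl
      have : carlesonSquare I ∩ R N = ∅ := by
        ext z
        simp only [Set.mem_inter_iff, Set.mem_empty_iff_false, iff_false, not_and]
        rintro ⟨-, -, h3⟩ h4
        rw [hR] at h4
        simp only [pow_zero, mul_one] at hl
        linarith
      simp [this]
    | succ k ih =>
      intro I hI hl
      obtain ⟨I₁, I₂, hc⟩ := hD.exists_children hI
      have hsub : carlesonSquare I ∩ R N ⊆
          squareTop I ∪ (carlesonSquare I₁ ∩ R N ∪ carlesonSquare I₂ ∩ R N) := by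
        rintro z ⟨hz, hzR⟩
        rcases carlesonSquare_children hc hz with h | h | h
        · exact Or.inl h
        · exact Or.inr (Or.inl ⟨h, hzR⟩)
        · exact Or.inr (Or.inr ⟨h, hzR⟩)
      calc ∫⁻ z in carlesonSquare I ∩ R N, g z ∂area
          ≤ ∫⁻ z in squareTop I ∪ (carlesonSquare I₁ ∩ R N ∪ carlesonSquare I₂ ∩ R N),
              g z ∂area := lintegral_mono_set hsub
        _ ≤ ∫⁻ z in squareTop I, g z ∂area + (∫⁻ z in carlesonSquare I₁ ∩ R N, g z ∂area +
              ∫⁻ z in carlesonSquare I₂ ∩ R N, g z ∂area) :=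
            (lintegral_union_le _ _ _).trans (by gcongr; exact lintegral_union_le _ _ _)
        _ ≤ ∫⁻ z in squareTop I, g z ∂area + (Φ I₁ + Φ I₂) := by
            gcongr
            · exact ih I₁ hc.mem₁ (by rw [hc.length₁, ← hl, pow_succ]; ring)
            · exact ih I₂ hc.mem₂ (by rw [hc.length₂, ← hl, pow_succ]; ring)
        _ ≤ Φ I := h I I₁ I₂ hc
  obtain ⟨n, hn⟩ := hD.length_dyadic I hI
  have hmono : Monotone fun N => carlesonSquare I ∩ R N := by
    intro M N hMN z hz
    have h2 := (hR M z).1 hz.2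
    have h3 : (1 / 2 : ℝ) ^ N ≤ (1 / 2 : ℝ) ^ M :=
      pow_le_pow_of_le_one (by norm_num) (by norm_num) hMN
    exact ⟨hz.1, (hR N z).2 (h3.trans h2)⟩
  have hU : carlesonSquare I = ⋃ N, carlesonSquare I ∩ R N := by
    refine Set.Subset.antisymm (fun z hz => ?_) (Set.iUnion_subset fun N => Set.inter_subset_left)
    have h1 : 0 < 1 - ‖z‖ := by
      have := hz.1
      simp only [disc, mem_ball_zero_iff] at this
      linarith
    obtain ⟨N, hN⟩ := exists_pow_lt_of_lt_one h1 (by norm_num : (1 / 2 : ℝ) < 1)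
    exact Set.mem_iUnion.2 ⟨N, hz, hN.le⟩
  rw [hU, setLIntegral_iUnion_of_directed _ hmono.directed_le]
  refine iSup_le fun N => ?_
  -- Lowering the cutoff from `2⁻ᴺ` to `2^(-(n + N))` places it exactly `N` generations below `I`.
  refine (lintegral_mono_set (hmono (Nat.le_add_left N n))).trans (key (n + N) N I hI ?_)
  rw [hn, pow_add, mul_assoc, ← mul_pow]
  norm_num

/-- These are countably many circles; the case `n = 0` excludes the origin. -/
theorem ae_not_boundary : ∀ᵐ z ∂area, ∀ n : ℕ, 1 - ‖z‖ ≠ (1 / 2 : ℝ) ^ n := by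
  rw [ae_all_iff]
  intro n
  refine area_absolutelyContinuous.ae_le ?_
  have : volume (Metric.sphere (0 : ℂ) (1 - (1 / 2 : ℝ) ^ n)) = 0 := Measure.addHaar_sphere _ _ _
  filter_upwards [measure_eq_zero_iff_ae_notMem.1 this] with z hz hzn
  exact hz (by rw [mem_sphere_zero_iff_norm, ← hzn]; ring)

/-- Almost every point of the disc lies in some `T(I)` and in the corresponding `squareTop I`. -/
theorem ae_mem_topHalf (hD : IsDyadicGrid D) :
    ∀ᵐ z ∂area, ∃ I ∈ D, z ∈ topHalf I ∧ z ∈ squareTop I := by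
  have h1 : ∀ᵐ z ∂area, z ∈ disc := by
    rw [← area_restrict_disc]; exact ae_restrict_mem measurableSet_disc
  filter_upwards [h1, ae_not_boundary] with z hz hzn
  have hz' : ‖z‖ < 1 := by simpa [disc] using hz
  have h0 : 0 < ‖z‖ := by
    rcases (norm_nonneg z).eq_or_lt with h | h
    · exact absurd (by rw [← h]; norm_num) (hzn 0)
    · exact h
  have hc : z / (‖z‖ : ℂ) ∈ circle := by
    simp [circle, h0.ne']
  obtain ⟨n, hn1, hn2⟩ := exists_nat_pow_near_of_lt_one (x := 1 - ‖z‖) (y := 1 / 2) (by linarith)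
    (by linarith) (by norm_num) (by norm_num)
  obtain ⟨I, hI, hzI, hl⟩ := hD.exists_arc hc n
  have hlt := lt_of_le_of_ne hn2 (hzn n)
  have hp := hD.arcLength_pos hI
  have hh : arcLength I / 2 < 1 - ‖z‖ := by rw [hl]; rw [pow_succ] at hn1; linarith
  refine ⟨I, hI, ⟨hz, ?_, ?_, hzI⟩, hz, hzI, hh.le, by rwa [hl]⟩
  · rw [lt_div_iff₀ hp]; linarith
  · rw [div_le_iff₀ hp, hl]; linarith

/-- Away from a null set `T(I)` and `squareTop I` agree. -/
theorem ae_mem_squareTop_iff (hD : IsDyadicGrid D) :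
    ∀ᵐ z ∂area, ∀ I ∈ D, z ∈ topHalf I ↔ z ∈ squareTop I := by
  filter_upwards [ae_not_boundary] with z hzn I hI
  obtain ⟨n, hn⟩ := hD.length_dyadic I hI
  have hp := hD.arcLength_pos hI
  simp only [topHalf, squareTop, Set.mem_ofPred_eq]
  rw [lt_div_iff₀ hp, div_le_iff₀ hp]
  constructor
  · rintro ⟨h1, h2, h3, h4⟩
    exact ⟨h1, h4, by linarith, lt_of_le_of_ne (by linarith) (by rw [hn]; exact hzn n)⟩
  · rintro ⟨h1, h2, h3, h4⟩
    refine ⟨h1, lt_of_le_of_ne (by linarith) fun h => hzn (n + 1) ?_, by linarith, h2⟩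
    rw [← h, hn, pow_succ]; ring

theorem topHalf_ae_eq (hD : IsDyadicGrid D) (hI : I ∈ D) : topHalf I =ᵐ[area] squareTop I := by
  filter_upwards [hD.ae_mem_squareTop_iff] with z hz
  exact propext (hz I hI)

/-- A dyadic arc shorter than `I` has at most half its length, too short for its square to reach the
top of `S(I)`. Thus the squares met by the maximal operator at `z` are those of the ancestors of
`I`. -/
theorem subset_iff_mem_carlesonSquare (hD : IsDyadicGrid D) (hI : I ∈ D) {J : Set ℂ} (hJ : J ∈ D)
    {z : ℂ} (hz : z ∈ squareTop I) : z ∈ carlesonSquare J ↔ I ⊆ J := by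
  constructor
  · rintro ⟨h1, h2, h3⟩
    refine hD.subset_of_mem hI hJ ?_ hz.2.1 h2
    by_contra! h
    have := hD.double_le hJ hI h
    linarith [hz.2.2.1]
  · exact fun h => hD.carlesonSquare_subset hI hJ h (squareTop_subset I hz)

end IsDyadicGrid

/-! ### Masses and averages over Carleson squares. -/

/-- The integral of `|w|` over `S(I) ∩ Ω`. -/
def squareMass (Ω : Set ℂ) (w : ℂ → ℝ) (I : Set ℂ) : ℝ :=
  (∫⁻ z in carlesonSquare I ∩ Ω, ‖w z‖ₑ ∂area).toReal

/-- The quotients whose supremum is the maximal function. -/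
def squareAverage (Ω : Set ℂ) (w : ℂ → ℝ) (I : Set ℂ) : ℝ :=
  squareMass Ω w I / squareArea I

theorem squareMass_nonneg (Ω : Set ℂ) (w : ℂ → ℝ) (I : Set ℂ) : 0 ≤ squareMass Ω w I :=
  ENNReal.toReal_nonneg

theorem setLIntegral_enorm_ne_top {Ω : Set ℂ} {w : ℂ → ℝ} (hw : IntegrableOn w Ω area) {s : Set ℂ}
    (hs : s ⊆ Ω) : ∫⁻ z in s, ‖w z‖ₑ ∂area ≠ ∞ :=
  ((lintegral_mono_set hs).trans_lt hw.2).ne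

theorem ofReal_squareMass {Ω : Set ℂ} {w : ℂ → ℝ} (hw : IntegrableOn w Ω area) (I : Set ℂ) :
    ENNReal.ofReal (squareMass Ω w I) = ∫⁻ z in carlesonSquare I ∩ Ω, ‖w z‖ₑ ∂area :=
  ENNReal.ofReal_toReal (setLIntegral_enorm_ne_top hw Set.inter_subset_right)

namespace IsDyadicGrid

variable {D : Set (Set ℂ)} {I : Set ℂ} {Ω : Set ℂ} {w : ℂ → ℝ}

theorem squareAverage_nonneg (hD : IsDyadicGrid D) (hI : I ∈ D) : 0 ≤ squareAverage Ω w I :=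
  div_nonneg (squareMass_nonneg _ _ _) (hD.squareArea_pos hI).le

theorem squareMass_eq (hD : IsDyadicGrid D) (hI : I ∈ D) :
    squareMass Ω w I = squareAverage Ω w I * squareArea I :=
  (div_mul_cancel₀ _ (hD.squareArea_pos hI).ne').symm

theorem ofReal_squareAverage (hD : IsDyadicGrid D) (hw : IntegrableOn w Ω area) (hI : I ∈ D) :
    ENNReal.ofReal (squareAverage Ω w I) =
      (∫⁻ z in carlesonSquare I ∩ Ω, ‖w z‖ₑ ∂area) / area (carlesonSquare I) := by
  rw [squareAverage, ENNReal.ofReal_div_of_pos (hD.squareArea_pos hI), ofReal_squareMass hw,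
    hD.area_carlesonSquare hI]

theorem squareMass_mono (hD : IsDyadicGrid D) (hw : IntegrableOn w Ω area) (hI : I ∈ D)
    {P : Set ℂ} (hP : P ∈ D) (h : I ⊆ P) : squareMass Ω w I ≤ squareMass Ω w P :=
  ENNReal.toReal_mono (setLIntegral_enorm_ne_top hw Set.inter_subset_right)
    (lintegral_mono_set (Set.inter_subset_inter_left _ (hD.carlesonSquare_subset hI hP h)))

/-- The mass increases with the arc and the areas scale at most quadratically. For a half of `P` the
factor is 4, which yields both the `log 4` in the oscillation bound and the exponent of the reverse
Hölder inequality. -/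
theorem squareAverage_le_mul (hD : IsDyadicGrid D) (hw : IntegrableOn w Ω area) (hI : I ∈ D)
    {P : Set ℂ} (hP : P ∈ D) (h : I ⊆ P) :
    squareAverage Ω w I ≤ (arcLength P / arcLength I) ^ 2 * squareAverage Ω w P := by
  have h1 := hD.squareArea_le_of_subset hI hP h
  have h2 := hD.squareMass_mono hw hI hP h
  rw [hD.squareMass_eq hP] at h2
  have h3 := hD.squareAverage_nonneg (Ω := Ω) (w := w) hP
  rw [squareAverage, div_le_iff₀ (hD.squareArea_pos hI)]
  nlinarith [mul_le_mul_of_nonneg_left h1 h3]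

theorem squareMass_children (hD : IsDyadicGrid D) (hΩ : MeasurableSet Ω)
    (hw : IntegrableOn w Ω area) {I₁ I₂ : Set ℂ} (h : IsChildren D I I₁ I₂) :
    (∫⁻ z in squareTop I ∩ Ω, ‖w z‖ₑ ∂area).toReal +
      (squareMass Ω w I₁ + squareMass Ω w I₂) ≤ squareMass Ω w I := by
  have hfin : ∀ s : Set ℂ, ∫⁻ z in s ∩ Ω, ‖w z‖ₑ ∂area ≠ ∞ :=
    fun s => setLIntegral_enorm_ne_top hw Set.inter_subset_right
  have h1 : Disjoint (carlesonSquare I₁ ∩ Ω) (carlesonSquare I₂ ∩ Ω) :=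
    Set.disjoint_left.2 fun z hz₁ hz₂ => Set.disjoint_left.1 h.disjoint hz₁.1.2.1 hz₂.1.2.1
  have h2 : Disjoint (squareTop I ∩ Ω) (carlesonSquare I₁ ∩ Ω ∪ carlesonSquare I₂ ∩ Ω) := by
    refine Set.disjoint_left.2 ?_
    rintro z ⟨⟨-, -, hz, -⟩, -⟩ (⟨hz', -⟩ | ⟨hz', -⟩)
    · have := hz'.2.2; rw [h.length₁] at this; linarith
    · have := hz'.2.2; rw [h.length₂] at this; linarith
  have hm₁ := (hD.measurableSet_carlesonSquare h.mem₁).inter hΩ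
  have hm₂ := (hD.measurableSet_carlesonSquare h.mem₂).inter hΩ
  have hsub₁ : I₁ ⊆ I := by rw [h.union]; exact Set.subset_union_left
  have hsub₂ : I₂ ⊆ I := by rw [h.union]; exact Set.subset_union_right
  rw [squareMass, squareMass, ← ENNReal.toReal_add (hfin _) (hfin _), ← lintegral_union hm₂ h1,
    ← ENNReal.toReal_add (hfin _), ← lintegral_union (hm₁.union hm₂) h2]
  · refine ENNReal.toReal_mono (hfin _) (lintegral_mono_set ?_)
    refine Set.union_subset ?_ (Set.union_subset ?_ ?_)
    · exact Set.inter_subset_inter_left _ (squareTop_subset I)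
    · exact Set.inter_subset_inter_left _ (hD.carlesonSquare_subset h.mem₁ h.mem hsub₁)
    · exact Set.inter_subset_inter_left _ (hD.carlesonSquare_subset h.mem₂ h.mem hsub₂)
  · exact setLIntegral_enorm_ne_top hw
      (Set.union_subset Set.inter_subset_right Set.inter_subset_right)

/-- A lower bound for a weight on `T(I)` is a lower bound for its average, up to a constant. -/
theorem le_squareAverage (hD : IsDyadicGrid D) (hw : IntegrableOn w Ω area) (hI : I ∈ D)
    (hIΩ : topHalf I ⊆ Ω) {c : ℝ} (hc : 0 ≤ c)
    (h : ∀ᵐ z ∂(area.restrict (topHalf I)), c ≤ w z) : c ≤ 4 * squareAverage Ω w I := by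
  have h1 : ENNReal.ofReal (c * topArea I) ≤ ENNReal.ofReal (squareMass Ω w I) := by
    rw [ofReal_squareMass hw, ENNReal.ofReal_mul hc, ← hD.area_topHalf hI]
    calc ENNReal.ofReal c * area (topHalf I) = ∫⁻ z in topHalf I, ENNReal.ofReal c ∂area := by
          rw [setLIntegral_const]
      _ ≤ ∫⁻ z in topHalf I, ‖w z‖ₑ ∂area := by
          refine lintegral_mono_ae ?_
          filter_upwards [h] with z hz
          rw [Real.enorm_eq_ofReal (hc.trans hz)]
          exact ENNReal.ofReal_le_ofReal hz
      -- `T(I)` contains the part of the circle `1 - ‖z‖ = |I|` that `S(I)` excludes, so inclusion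
      -- in `S(I)` holds only up to a null set.
      _ = ∫⁻ z in squareTop I ∩ topHalf I, ‖w z‖ₑ ∂area := by
          refine setLIntegral_congr ?_
          conv_lhs => rw [← Set.inter_self (topHalf I)]
          exact (hD.topHalf_ae_eq hI).inter (ae_eq_refl _)
      _ ≤ ∫⁻ z in carlesonSquare I ∩ Ω, ‖w z‖ₑ ∂area :=
          lintegral_mono_set (Set.inter_subset_inter (squareTop_subset I) hIΩ)
  rw [ENNReal.ofReal_le_ofReal_iff (squareMass_nonneg _ _ _), hD.squareMass_eq hI] at h1
  have h2 := mul_le_mul_of_nonneg_left (hD.squareArea_le hI)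
    (hD.squareAverage_nonneg (Ω := Ω) (w := w) hI)
  exact le_of_mul_le_mul_right (by linarith) (hD.topArea_pos hI)

theorem squareAverage_le_of_maximalOp (hD : IsDyadicGrid D) (hw : IntegrableOn w Ω area)
    {x : ℝ} (hx : 0 ≤ x) {z : ℂ} (hz : z ∈ Ω) (h : maximalOp D Ω w z ≤ ENNReal.ofReal x)
    (hI : I ∈ D) (hzI : z ∈ carlesonSquare I) : squareAverage Ω w I ≤ x := by
  rw [← ENNReal.ofReal_le_ofReal_iff hx, hD.ofReal_squareAverage hw hI]
  refine le_trans ?_ h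
  exact le_iSup₂_of_le I hI (le_iSup_of_le ⟨hzI, hz⟩ le_rfl)

theorem maximalOp_le (hD : IsDyadicGrid D) {x : ℝ} {z : ℂ}
    (h : ∀ I ∈ D, z ∈ carlesonSquare I → ∫⁻ ζ in carlesonSquare I ∩ Ω, ‖w ζ‖ₑ ∂area ≤
      ENNReal.ofReal (x * squareArea I)) :
    maximalOp D Ω w z ≤ ENNReal.ofReal x := by
  refine iSup₂_le fun I hI => iSup_le fun hz => ?_
  have hp := hD.squareArea_pos hI
  rw [hD.area_carlesonSquare hI, ENNReal.div_le_iff (by simpa using hp) ENNReal.ofReal_ne_top]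
  refine (h I hI hz.1).trans_eq (ENNReal.ofReal_mul' hp.le)

/-- On `T(I)` a weight of bounded oscillation varies by at most a constant factor. -/
theorem ae_le_exp_mul (hD : IsDyadicGrid D) (hpos : ∀ᵐ z ∂(area.restrict Ω), 0 < w z) {L : ℝ}
    (hL : ∀ᵐ z ∂(area.restrict Ω), ∀ᵐ ζ ∂(area.restrict Ω),
      |Real.log (w z) - Real.log (w ζ)| ≤ L * (1 + dyadicDist D z ζ)) :
    ∀ᵐ z ∂(area.restrict Ω), ∀ I ∈ D, z ∈ topHalf I → topHalf I ⊆ Ω →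
      ∀ᵐ ζ ∂(area.restrict (topHalf I)), 0 < w ζ ∧ w z ≤ Real.exp L * w ζ := by
  filter_upwards [hpos, hL] with z hz hLz I hI hzI hIΩ
  filter_upwards [ae_restrict_of_ae_restrict_of_subset hIΩ hpos,
    ae_restrict_of_ae_restrict_of_subset hIΩ hLz,
    ae_restrict_mem (hD.measurableSet_topHalf hI)] with ζ hζ hLζ hζI
  rw [hD.dyadicDist_self hI hzI hζI, add_zero, mul_one] at hLζ
  refine ⟨hζ, ?_⟩
  rw [← Real.log_le_log_iff hz (by positivity), Real.log_mul (Real.exp_pos L).ne' hζ.ne',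
    Real.log_exp]
  linarith [(abs_le.1 hLζ).2]

/-- A weight of bounded oscillation is dominated by its averages. -/
theorem ae_le_squareAverage (hD : IsDyadicGrid D) (hpos : ∀ᵐ z ∂(area.restrict Ω), 0 < w z)
    {L : ℝ} (hL : ∀ᵐ z ∂(area.restrict Ω), ∀ᵐ ζ ∂(area.restrict Ω),
      |Real.log (w z) - Real.log (w ζ)| ≤ L * (1 + dyadicDist D z ζ)) {q : ℝ} (hq : 0 ≤ q)
    (hw : IntegrableOn (fun z => w z ^ q) Ω area) :
    ∀ᵐ z ∂(area.restrict Ω), ∀ I ∈ D, z ∈ topHalf I → topHalf I ⊆ Ω →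
      w z ^ q ≤ 4 * Real.exp L ^ q * squareAverage Ω (fun z => w z ^ q) I := by
  filter_upwards [hpos, hD.ae_le_exp_mul hpos hL] with z hz h I hI hzI hIΩ
  have he : 0 < Real.exp L ^ q := Real.rpow_pos_of_pos (Real.exp_pos L) q
  have h1 : w z ^ q / Real.exp L ^ q ≤ 4 * squareAverage Ω (fun z => w z ^ q) I := by
    refine hD.le_squareAverage hw hI hIΩ (by positivity) ?_
    filter_upwards [h I hI hzI hIΩ] with ζ hζ
    rw [div_le_iff₀' he, ← Real.mul_rpow (Real.exp_pos L).le hζ.1.le]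
    exact Real.rpow_le_rpow hz.le hζ.2 hq
  rw [div_le_iff₀ he] at h1
  linarith

end IsDyadicGrid

/-! ### The converse: reverse Hölder inequality. -/

namespace IsDyadicGrid
variable {D : Set (Set ℂ)}

/-- The `B₁` condition forces the masses of the children to decrease by a fixed factor. -/
theorem squareMass_children_le (hD : IsDyadicGrid D) {W : ℂ → ℝ} {C : ℝ} (hC : 0 < C)
    (hint : IntegrableOn W disc area) (hB : ∀ᵐ z ∂area, ∀ I ∈ D, z ∈ carlesonSquare I →
      squareAverage disc W I ≤ C * W z)
    {I I₁ I₂ : Set ℂ} (h : IsChildren D I I₁ I₂) :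
    squareMass disc W I₁ + squareMass disc W I₂ ≤ (1 - 1 / (4 * C)) * squareMass disc W I := by
  have h1 := hD.squareMass_children measurableSet_disc hint h
  have hv := hD.squareAverage_nonneg (Ω := disc) (w := W) h.mem
  have hdisc : squareTop I ∩ disc = squareTop I := Set.inter_eq_left.2 fun _ hz => hz.1
  have h2 : squareAverage disc W I / C * topArea I ≤
      (∫⁻ z in squareTop I ∩ disc, ‖W z‖ₑ ∂area).toReal := by
    rw [← ENNReal.ofReal_le_iff_le_toReal
      (setLIntegral_enorm_ne_top hint Set.inter_subset_right), hdisc,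
      ENNReal.ofReal_mul (by positivity), ← hD.area_squareTop h.mem, ← setLIntegral_const]
    refine setLIntegral_mono_ae' (hD.measurableSet_squareTop h.mem) ?_
    filter_upwards [hB] with z hz hzI
    have h3 := hz I h.mem (squareTop_subset I hzI)
    rw [← div_le_iff₀' hC] at h3
    rw [Real.enorm_eq_ofReal (le_trans (by positivity) h3)]
    exact ENNReal.ofReal_le_ofReal h3
  -- The top has at least a quarter of the area, and there `W` is at least the average divided by
  -- `C`.
  have h4 : 1 / (4 * C) * squareMass disc W I ≤ squareAverage disc W I / C * topArea I := by
    rw [hD.squareMass_eq h.mem]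
    have := mul_le_mul_of_nonneg_left (hD.squareArea_le h.mem)
      (show 0 ≤ squareAverage disc W I / (4 * C) by positivity)
    calc _ = squareAverage disc W I / (4 * C) * squareArea I := by ring
      _ ≤ _ := this
      _ = _ := by field_simp
  linarith

/-- Reverse Hölder inequality for `B₁` weights of bounded oscillation. -/
theorem exists_reverse_holder (hD : IsDyadicGrid D) {W : ℂ → ℝ} {C L : ℝ} (hC : 1 ≤ C)
    (hint : IntegrableOn W disc area) (hpos : ∀ᵐ z ∂area, 0 < W z)
    (hB : ∀ᵐ z ∂area, ∀ I ∈ D, z ∈ carlesonSquare I → squareAverage disc W I ≤ C * W z)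
    (hL : ∀ᵐ z ∂area, ∀ I ∈ D, z ∈ topHalf I → W z ≤ L * squareAverage disc W I) (hL0 : 0 < L) :
    ∃ q K : ℝ, 1 < q ∧ 0 < K ∧ ∀ I ∈ D, ∫⁻ z in carlesonSquare I, ‖W z ^ q‖ₑ ∂area ≤
      ENNReal.ofReal (K * squareAverage disc W I ^ q * squareArea I) := by
  set δ : ℝ := 1 / (4 * C) with hδ
  have hδ0 : 0 < δ := by positivity
  have hδ1 : δ ≤ 1 := by rw [hδ, div_le_one (by positivity)]; linarith
  -- Chosen so that the growth of averages by 4 costs only `4 ^ ε = 1 + δ`, which the mass loss `1 -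
  -- δ` outweighs.
  set ε : ℝ := Real.logb 4 (1 + δ) with hε
  have hε0 : 0 < ε := Real.logb_pos (by norm_num) (by linarith)
  have h4 : (4 : ℝ) ^ ε = 1 + δ := Real.rpow_logb (by norm_num) (by norm_num) (by linarith)
  have hq0 : 0 < 1 + ε := by linarith
  set K : ℝ := L ^ (1 + ε) / δ ^ 2 with hK
  have hLq : 0 < L ^ (1 + ε) := Real.rpow_pos_of_pos hL0 _
  have hK0 : 0 < K := by positivity
  refine ⟨1 + ε, K, by linarith, hK0, fun I hI => ?_⟩
  -- The supersolution is `K` times mass times average to the power `ε`. The halves retain at most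
  -- `(1 - δ) * (1 + δ) = 1 - δ ^ 2` of it, and `K` makes the remaining `δ ^ 2` pay for the top.
  have key : ∫⁻ z in carlesonSquare I, ‖W z ^ (1 + ε)‖ₑ ∂area ≤
      ENNReal.ofReal (K * (squareMass disc W I * squareAverage disc W I ^ ε)) := by
    refine hD.lintegral_le_of_supersolution
      (Φ := fun I => ENNReal.ofReal (K * (squareMass disc W I * squareAverage disc W I ^ ε)))
      (fun I I₁ I₂ h => ?_) hI
    have hG := squareMass_nonneg disc W I
    have hG₁ := squareMass_nonneg disc W I₁
    have hG₂ := squareMass_nonneg disc W I₂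
    have hv := hD.squareAverage_nonneg (Ω := disc) (w := W) h.mem
    have hv₁ := hD.squareAverage_nonneg (Ω := disc) (w := W) h.mem₁
    have hv₂ := hD.squareAverage_nonneg (Ω := disc) (w := W) h.mem₂
    have hsub₁ : I₁ ⊆ I := by rw [h.union]; exact Set.subset_union_left
    have hsub₂ : I₂ ⊆ I := by rw [h.union]; exact Set.subset_union_right
    have hp := hD.arcLength_pos h.mem
    have hpow : ∀ J ∈ D, J ⊆ I → arcLength J = arcLength I / 2 →
        squareAverage disc W J ^ ε ≤ (1 + δ) * squareAverage disc W I ^ ε := by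
      intro J hJ hJI hl
      have := hD.squareAverage_le_mul hint hJ h.mem hJI
      rw [hl, show arcLength I / (arcLength I / 2) = 2 by field_simp] at this
      rw [← h4, ← Real.mul_rpow (by norm_num) hv]
      refine Real.rpow_le_rpow (hD.squareAverage_nonneg hJ) ?_ hε0.le
      linarith
    have hp₁ := hpow I₁ h.mem₁ hsub₁ h.length₁
    have hp₂ := hpow I₂ h.mem₂ hsub₂ h.length₂
    have hch := hD.squareMass_children_le (by linarith) hint hB h
    rw [← hδ] at hch
    set v := squareAverage disc W I with hvdef
    have htop : ∫⁻ z in squareTop I, ‖W z ^ (1 + ε)‖ₑ ∂area ≤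
        ENNReal.ofReal (L ^ (1 + ε) * (squareMass disc W I * v ^ ε)) := by
      calc ∫⁻ z in squareTop I, ‖W z ^ (1 + ε)‖ₑ ∂area
          ≤ ∫⁻ z in squareTop I, ENNReal.ofReal ((L * v) ^ (1 + ε)) ∂area := by
            refine setLIntegral_mono_ae' (hD.measurableSet_squareTop h.mem) ?_
            filter_upwards [hpos, hL, hD.ae_mem_squareTop_iff] with z hz hLz hiff hzI
            rw [Real.enorm_eq_ofReal (Real.rpow_nonneg hz.le _)]
            exact ENNReal.ofReal_le_ofReal (Real.rpow_le_rpow hz.le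
              (hLz I h.mem ((hiff I h.mem).2 hzI)) hq0.le)
        _ = ENNReal.ofReal ((L * v) ^ (1 + ε) * topArea I) := by
            rw [setLIntegral_const, hD.area_squareTop h.mem, ENNReal.ofReal_mul (by positivity)]
        _ ≤ _ := by
            refine ENNReal.ofReal_le_ofReal ?_
            rw [Real.mul_rpow hL0.le hv, hD.squareMass_eq h.mem, ← hvdef,
              Real.rpow_add_of_nonneg hv zero_le_one hε0.le, Real.rpow_one]
            have : topArea I ≤ squareArea I := by
              have h5 := squareArea_children h
              have h6 := hD.squareArea_pos h.mem₁
              have h7 := hD.squareArea_pos h.mem₂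
              linarith
            have := mul_le_mul_of_nonneg_left this
              (show 0 ≤ L ^ (1 + ε) * (v * v ^ ε) by positivity)
            linarith
    have hvε : 0 ≤ v ^ ε := Real.rpow_nonneg hv _
    have hvε₁ : 0 ≤ squareAverage disc W I₁ ^ ε := Real.rpow_nonneg hv₁ _
    have hvε₂ : 0 ≤ squareAverage disc W I₂ ^ ε := Real.rpow_nonneg hv₂ _
    refine (add_le_add_left htop _).trans ?_
    rw [← ENNReal.ofReal_add (by positivity) (by positivity),
      ← ENNReal.ofReal_add (by positivity) (by positivity)]
    refine ENNReal.ofReal_le_ofReal ?_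
    have hKδ : L ^ (1 + ε) = K * δ ^ 2 := by rw [hK]; field_simp
    rw [hKδ]
    have e1 := mul_le_mul_of_nonneg_left hp₁ hG₁
    have e2 := mul_le_mul_of_nonneg_left hp₂ hG₂
    have e3 := mul_le_mul_of_nonneg_right hch (show 0 ≤ (1 + δ) * v ^ ε by positivity)
    have e4 : δ ^ 2 * (squareMass disc W I * v ^ ε) + (squareMass disc W I₁ *
        squareAverage disc W I₁ ^ ε + squareMass disc W I₂ * squareAverage disc W I₂ ^ ε) ≤
        squareMass disc W I * v ^ ε := by nlinarith
    nlinarith [mul_le_mul_of_nonneg_left e4 hK0.le]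
  refine key.trans_eq ?_
  rw [hD.squareMass_eq hI, Real.rpow_add_of_nonneg (hD.squareAverage_nonneg hI) zero_le_one hε0.le,
    Real.rpow_one]
  congr 1; ring

end IsDyadicGrid

theorem B1Bound.mono {D : Set (Set ℂ)} {Ω : Set ℂ} {w : ℂ → ℝ} {C C' : ℝ}
    (h : B1Bound D Ω w C) (hpos : ∀ᵐ z ∂(area.restrict Ω), 0 ≤ w z) (hC : C ≤ C') :
    B1Bound D Ω w C' := by
  refine ⟨h.1.trans_le hC, ?_⟩
  filter_upwards [h.2, hpos] with z hz hz0
  exact hz.trans (ENNReal.ofReal_le_ofReal (mul_le_mul_of_nonneg_right hC hz0))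

/-- The restriction of a `B₁` weight of bounded oscillation has a power `q > 1` in `B₁`. -/
theorem exists_rpow_memB1 {D : Set (Set ℂ)} (hD : IsDyadicGrid D) {Ω : Set ℂ} (hΩ : Ω ⊆ disc)
    {w W : ℂ → ℝ} (hW : MemB1 D disc W) (hosc : IsDyadicBHO D disc W)
    (hwW : ∀ᵐ z ∂(area.restrict Ω), w z = W z) :
    ∃ q : ℝ, 1 < q ∧ MemB1 D Ω (fun z => w z ^ q) := by
  obtain ⟨C₀, hC₀⟩ := hW.exists_bound
  obtain ⟨L, hL0, hL⟩ := hosc.exists_bound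
  have hint := hW.integrable
  -- The bound `C ≥ 1` ensures `δ = 1 / (4 * C) ≤ 1` in the reverse Hölder inequality.
  set C : ℝ := max C₀ 1 with hCdef
  have hCB := (hC₀.mono hW.nonneg (le_max_left C₀ 1)).2
  have hpos' := hosc.pos
  have hpos : ∀ᵐ z ∂area, 0 < W z := by rw [← area_restrict_disc]; exact hpos'
  have hB : ∀ᵐ z ∂area, ∀ I ∈ D, z ∈ carlesonSquare I → squareAverage disc W I ≤ C * W z := by
    rw [area_restrict_disc] at hCB
    filter_upwards [hCB, hpos] with z hz hz0 I hI hzI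
    exact hD.squareAverage_le_of_maximalOp hint (by positivity) hzI.1 hz hI hzI
  have hLav : ∀ᵐ z ∂area, ∀ I ∈ D, z ∈ topHalf I →
      W z ≤ 4 * Real.exp L * squareAverage disc W I := by
    have := hD.ae_le_squareAverage hpos' hL zero_le_one (by simpa using hint)
    rw [area_restrict_disc] at this
    filter_upwards [this] with z hz I hI hzI
    simpa using hz I hI hzI fun _ hζ => hζ.1
  obtain ⟨q, K, hq, hK, hKI⟩ := hD.exists_reverse_holder (le_max_right C₀ 1) hint hpos hB hLav
    (by positivity)
  have hC1 : 0 < C := lt_max_of_lt_right one_pos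
  have hle : ∀ I ∈ D, ∫⁻ z in carlesonSquare I ∩ Ω, ‖w z ^ q‖ₑ ∂area ≤
      ENNReal.ofReal (K * squareAverage disc W I ^ q * squareArea I) := by
    intro I hI
    refine le_trans ?_ (hKI I hI)
    calc ∫⁻ z in carlesonSquare I ∩ Ω, ‖w z ^ q‖ₑ ∂area
        = ∫⁻ z in carlesonSquare I ∩ Ω, ‖W z ^ q‖ₑ ∂area := by
          refine lintegral_congr_ae ?_
          filter_upwards [ae_restrict_of_ae_restrict_of_subset Set.inter_subset_right hwW]
            with z hz
          rw [hz]
      _ ≤ _ := lintegral_mono_set Set.inter_subset_left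
  -- `K` comes from the reverse Hölder inequality and `C ^ q` from bounding the average of `W` by `C
  -- * W z`.
  refine ⟨q, hq, ⟨?_, ?_⟩, ?_, K * C ^ q, by positivity, ?_⟩
  · have hWm : AEMeasurable W (area.restrict Ω) :=
      hosc.aemeasurable.mono_measure (Measure.restrict_mono hΩ le_rfl)
    exact ((hWm.congr (hwW.mono fun z hz => hz.symm)).pow_const q).aestronglyMeasurable
  · rw [HasFiniteIntegral]
    have hae : (Ω : Set ℂ) =ᵐ[area] (carlesonSquare circle ∩ Ω : Set ℂ) := by
      filter_upwards [hD.ae_mem_topHalf] with z hz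
      obtain ⟨I, hI, -, hzI⟩ := hz
      have := hD.carlesonSquare_subset hI hD.circle_mem (hD.subset_circle hI)
        (squareTop_subset I hzI)
      exact propext ⟨fun h => ⟨this, h⟩, fun h => h.2⟩
    rw [setLIntegral_congr hae]
    exact (hle _ hD.circle_mem).trans_lt ENNReal.ofReal_lt_top
  · filter_upwards [hwW, ae_restrict_of_ae hpos] with z hz hz0
    rw [hz]; positivity
  · filter_upwards [hwW, ae_restrict_of_ae hpos, ae_restrict_of_ae hB] with z hz hz0 hBz
    refine hD.maximalOp_le fun I hI hzI => (hle I hI).trans (ENNReal.ofReal_le_ofReal ?_)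
    have h1 := Real.rpow_le_rpow (hD.squareAverage_nonneg hI) (hBz I hI hzI)
      (by linarith : 0 ≤ q)
    rw [Real.mul_rpow hC1.le hz0.le] at h1
    rw [hz]
    have := mul_le_mul_of_nonneg_right (mul_le_mul_of_nonneg_left h1 hK.le)
      (hD.squareArea_pos hI).le
    linarith

/-- A sequence of admissible constants tending to the infimum leaves only countably many null sets.
Positivity of the infimum is not part of the conclusion; it is derived later from bounded
oscillation. -/
theorem ae_maximalOp_le_b1Const {D : Set (Set ℂ)} {Ω : Set ℂ} {w : ℂ → ℝ}
    (h : ∃ C, B1Bound D Ω w C) : ∀ᵐ z ∂(area.restrict Ω),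
      maximalOp D Ω w z ≤ ENNReal.ofReal (b1Const D Ω w * w z) := by
  have hbdd : BddBelow {C : ℝ | B1Bound D Ω w C} := ⟨0, fun C hC => hC.1.le⟩
  obtain ⟨u, -, hu, hmem⟩ := exists_seq_tendsto_sInf (S := {C : ℝ | B1Bound D Ω w C}) h hbdd
  have hae := ae_all_iff.2 fun n => (hmem n).2
  filter_upwards [hae] with z hz
  exact ge_of_tendsto' ((ENNReal.continuous_ofReal.tendsto _).comp (hu.mul_const (w z))) hz

theorem oscBound_oscConst {D : Set (Set ℂ)} {Ω : Set ℂ} {w : ℂ → ℝ}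
    (h : ∃ L, OscBound D Ω w L) : OscBound D Ω w (oscConst D Ω w) := by
  have hbdd : BddBelow {L : ℝ | OscBound D Ω w L} := ⟨0, fun L hL => hL.1⟩
  obtain ⟨u, -, hu, hmem⟩ := exists_seq_tendsto_sInf (S := {L : ℝ | OscBound D Ω w L}) h hbdd
  refine ⟨ge_of_tendsto' hu fun n => (hmem n).1, ?_⟩
  filter_upwards [ae_all_iff.2 fun n => (hmem n).2] with z hz
  filter_upwards [ae_all_iff.2 hz] with ζ hζ
  exact ge_of_tendsto' (hu.mul_const _) hζ

/-- A form of Young's inequality. -/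
theorem mul_le_add_rpow_mul_rpow {q x m : ℝ} (hq : 1 ≤ q) (hx : 0 ≤ x) (hm : 0 < m) :
    q * x ≤ (q - 1) * m + x ^ q * m ^ (1 - q) := by
  -- Bernoulli's inequality for `(1 + (x / m - 1)) ^ q`, multiplied by `m`.
  have h1 : -1 ≤ x / m - 1 := by
    have : 0 ≤ x / m := by positivity
    linarith
  have h2 := one_add_mul_self_le_rpow_one_add h1 hq
  rw [add_sub_cancel, Real.div_rpow hx hm.le] at h2
  have h3 := mul_le_mul_of_nonneg_right h2 hm.le
  have h4 : x ^ q / m ^ q * m = x ^ q * m ^ (1 - q) := by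
    rw [Real.rpow_sub hm, Real.rpow_one]; ring
  have h5 : (1 + q * (x / m - 1)) * m = m + q * x - q * m := by field_simp; ring
  rw [h4, h5] at h3
  linarith

/-! ### The maximal function on top halves. -/

/-- The value of the maximal function on `T(I)`. -/
def maxAverage (D : Set (Set ℂ)) (Ω : Set ℂ) (u : ℂ → ℝ) (I : Set ℂ) : ℝ :=
  sSup (squareAverage Ω u '' {J | J ∈ D ∧ I ⊆ J})

namespace IsDyadicGrid

variable {D : Set (Set ℂ)} {I : Set ℂ} {Ω : Set ℂ} {u : ℂ → ℝ}

theorem squareAverage_le_maxAverage (hD : IsDyadicGrid D) (hu : IntegrableOn u Ω area)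
    (hI : I ∈ D) {J : Set ℂ} (hJ : J ∈ D) (h : I ⊆ J) :
    squareAverage Ω u J ≤ maxAverage D Ω u I := by
  refine le_csSup ⟨(1 / arcLength I) ^ 2 * squareAverage Ω u circle, ?_⟩ ⟨J, ⟨hJ, h⟩, rfl⟩
  rintro _ ⟨K, ⟨hK, hIK⟩, rfl⟩
  have h1 := hD.squareAverage_le_mul hu hK hD.circle_mem (hD.subset_circle hK)
  rw [arcLength_circle] at h1
  refine h1.trans ?_
  have h2 := hD.arcLength_le_of_subset hI hK hIK
  have h3 := hD.arcLength_pos hI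
  have h4 := hD.arcLength_pos hK
  have h5 := hD.squareAverage_nonneg (Ω := Ω) (w := u) hD.circle_mem
  gcongr

theorem maxAverage_le (hI : I ∈ D) {x : ℝ} (h : ∀ J ∈ D, I ⊆ J → squareAverage Ω u J ≤ x) :
    maxAverage D Ω u I ≤ x := by
  refine csSup_le ⟨_, I, ⟨hI, le_rfl⟩, rfl⟩ ?_
  rintro _ ⟨J, ⟨hJ, hIJ⟩, rfl⟩
  exact h J hJ hIJ

theorem maxAverage_anti (hD : IsDyadicGrid D) (hu : IntegrableOn u Ω area) (hI : I ∈ D)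
    {P : Set ℂ} (hP : P ∈ D) (h : I ⊆ P) : maxAverage D Ω u P ≤ maxAverage D Ω u I :=
  maxAverage_le hP fun _ hJ hPJ => hD.squareAverage_le_maxAverage hu hI hJ (h.trans hPJ)

/-- The only arc containing `K` that does not contain its parent is `K` itself. So in passing to a
half, `μ` either stays or jumps to the new average. -/
theorem maxAverage_child (hD : IsDyadicGrid D) (hu : IntegrableOn u Ω area) (hI : I ∈ D)
    {K : Set ℂ} (hK : K ∈ D) (h : K ⊆ I) (hl : arcLength K = arcLength I / 2) :
    maxAverage D Ω u K = max (maxAverage D Ω u I) (squareAverage Ω u K) := by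
  refine le_antisymm (maxAverage_le hK fun J hJ hKJ => ?_) (max_le (hD.maxAverage_anti hu hK hI h)
    (hD.squareAverage_le_maxAverage hu hK hK le_rfl))
  rcases hD.eq_or_subset_of_children hI hK h hl hJ hKJ with rfl | hIJ
  · exact le_max_right _ _
  · exact (hD.squareAverage_le_maxAverage hu hI hJ hIJ).trans (le_max_left _ _)

/-- An ancestor of `I` inside `P` loses at most the quadratic factor against `P`; one containing `P`
already competes for `P`. -/
theorem maxAverage_le_mul (hD : IsDyadicGrid D) (hu : IntegrableOn u Ω area) (hI : I ∈ D)
    {P : Set ℂ} (hP : P ∈ D) (h : I ⊆ P) :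
    maxAverage D Ω u I ≤ (arcLength P / arcLength I) ^ 2 * maxAverage D Ω u P := by
  have hlI := hD.arcLength_pos hI
  have hle := hD.arcLength_le_of_subset hI hP h
  have h0 : 0 ≤ maxAverage D Ω u P :=
    (hD.squareAverage_nonneg hP).trans (hD.squareAverage_le_maxAverage hu hP hP le_rfl)
  refine maxAverage_le hI fun J hJ hIJ => ?_
  obtain ⟨x, hx⟩ := hD.nonempty hI
  have hlJ := hD.arcLength_le_of_subset hI hJ hIJ
  rcases le_total (arcLength J) (arcLength P) with hl | hl
  · have hJP := hD.subset_of_mem hJ hP hl (hIJ hx) (h hx)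
    refine (hD.squareAverage_le_mul hu hJ hP hJP).trans ?_
    have h1 := hD.squareAverage_le_maxAverage hu hP hP le_rfl
    have h2 := hD.squareAverage_nonneg (Ω := Ω) (w := u) hP
    have h3 := hD.arcLength_pos hP
    have h4 := hlI.trans_le hlJ
    gcongr
  · have hPJ := hD.subset_of_mem hP hJ hl (h hx) (hIJ hx)
    refine (hD.squareAverage_le_maxAverage hu hP hJ hPJ).trans ?_
    have : 1 ≤ arcLength P / arcLength I := by rwa [one_le_div hlI]
    exact le_mul_of_one_le_left h0 (one_le_pow₀ this)

/-- Both values lie between `μ P` and `4 ^ β * μ P` for the common ancestor `P`, so the difference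
of logarithms costs `β * log 4` once, not twice. -/
theorem abs_log_maxAverage_sub_le (hD : IsDyadicGrid D) (hu : IntegrableOn u Ω area)
    (hpos : ∀ I ∈ D, 0 < maxAverage D Ω u I) {J : Set ℂ} (hI : I ∈ D) (hJ : J ∈ D) {z ζ : ℂ}
    (hz : z ∈ topHalf I) (hζ : ζ ∈ topHalf J) :
    |Real.log (maxAverage D Ω u I) - Real.log (maxAverage D Ω u J)| ≤
      Real.log 4 * dyadicDist D z ζ := by
  obtain ⟨P, hP, hIP, hJP, -, h1, h2⟩ := hD.dyadicDist_spec hI hJ hz hζ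
  have hlog4 : Real.log 4 = 2 * Real.log 2 := by
    rw [show (4 : ℝ) = 2 ^ 2 by norm_num, Real.log_pow]; norm_num
  have key : ∀ A ∈ D, A ⊆ P → Real.logb 2 (arcLength P / arcLength A) ≤ dyadicDist D z ζ →
      Real.log (maxAverage D Ω u A) - Real.log (maxAverage D Ω u P) ≤
        Real.log 4 * dyadicDist D z ζ := by
    intro A hA hAP hβ
    have hlA := hD.arcLength_pos hA
    have hlP := hD.arcLength_pos hP
    have h3 := Real.log_le_log (hpos A hA) (hD.maxAverage_le_mul hu hA hP hAP)
    rw [Real.log_mul (by positivity) (hpos P hP).ne', Real.log_pow] at h3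
    rw [Real.logb, div_le_iff₀ (Real.log_pos one_lt_two)] at hβ
    push_cast at h3
    rw [hlog4]
    linarith
  have hPI := Real.log_le_log (hpos P hP) (hD.maxAverage_anti hu hI hP hIP)
  have hPJ := Real.log_le_log (hpos P hP) (hD.maxAverage_anti hu hJ hP hJP)
  rw [abs_le]
  constructor
  · linarith [key J hJ hJP h2]
  · linarith [key I hI hIP h1]

theorem lintegral_const_squareTop (hD : IsDyadicGrid D) (hI : I ∈ D) (φ : Set ℂ → ℝ)
    (hφ : 0 ≤ φ I) : ∫⁻ z in squareTop I, ‖φ (arcOf D z)‖ₑ ∂area =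
      ENNReal.ofReal (φ I * topArea I) := by
  rw [ENNReal.ofReal_mul hφ, ← hD.area_squareTop hI, ← setLIntegral_const]
  refine setLIntegral_congr_fun_ae (hD.measurableSet_squareTop hI) ?_
  filter_upwards [hD.ae_mem_squareTop_iff] with z hz hzI
  rw [hD.arcOf_eq hI ((hz I hI).2 hzI), Real.enorm_eq_ofReal hφ]

/-- The maximal function to the power `1 / q` is in `B₁`, with constant `q / (q - 1)`. -/
theorem lintegral_maxAverage_rpow_le (hD : IsDyadicGrid D) (hΩ : MeasurableSet Ω)
    (hu : IntegrableOn u Ω area) (hpos : ∀ I ∈ D, 0 < maxAverage D Ω u I) {q : ℝ} (hq : 1 < q)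
    (hI : I ∈ D) :
    ∫⁻ z in carlesonSquare I, ‖maxAverage D Ω u (arcOf D z) ^ (1 / q)‖ₑ ∂area ≤
      ENNReal.ofReal (q / (q - 1) * maxAverage D Ω u I ^ (1 / q) * squareArea I) := by
  have hq0 : 0 < q := by linarith
  have hq1 : 0 < q - 1 := by linarith
  set m : Set ℂ → ℝ := fun I => maxAverage D Ω u I ^ (1 / q) with hm
  have hm0 : ∀ I ∈ D, 0 < m I := fun I hI => Real.rpow_pos_of_pos (hpos I hI) _
  have hmq : ∀ I ∈ D, m I ^ q = maxAverage D Ω u I := fun I hI => by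
    rw [hm, ← Real.rpow_mul (hpos I hI).le, one_div_mul_cancel hq0.ne', Real.rpow_one]
  have hmm : ∀ I ∈ D, m I ^ (1 - q) * m I ^ q = m I := fun I hI => by
    rw [← Real.rpow_add (hm0 I hI), sub_add_cancel, Real.rpow_one]
  -- The second term of the supersolution stores the mass that may still produce jumps of the
  -- maximal function below `I`.
  have key : ∫⁻ z in carlesonSquare I, ‖m (arcOf D z)‖ₑ ∂area ≤
      ENNReal.ofReal (m I * squareArea I + m I ^ (1 - q) * squareMass Ω u I / (q - 1)) := by
    refine hD.lintegral_le_of_supersolution (Φ := fun I => ENNReal.ofReal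
      (m I * squareArea I + m I ^ (1 - q) * squareMass Ω u I / (q - 1))) (fun I I₁ I₂ h => ?_) hI
    have hmI := hm0 I h.mem
    have hsub₁ : I₁ ⊆ I := by rw [h.union]; exact Set.subset_union_left
    have hsub₂ : I₂ ⊆ I := by rw [h.union]; exact Set.subset_union_right
    have child : ∀ K ∈ D, K ⊆ I → arcLength K = arcLength I / 2 →
        m K * squareArea K + m K ^ (1 - q) * squareMass Ω u K / (q - 1) ≤
          m I * squareArea K + m I ^ (1 - q) * squareMass Ω u K / (q - 1) := by
      intro K hK hKI hl
      have hmK := hm0 K hK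
      have hA := hD.squareArea_pos hK
      -- Without a jump there is equality. At a jump the average of `u` over `K` is `m K ^ q`, and
      -- Young's inequality shows that the stored mass pays for replacing `m I` by `m K`.
      rcases max_choice (maxAverage D Ω u I) (squareAverage Ω u K) with hc | hc
      · have : m K = m I := by
          simp only [hm]; rw [hD.maxAverage_child hu h.mem hK hKI hl, hc]
        rw [this]
      · have hav : squareAverage Ω u K = m K ^ q := by
          rw [hmq K hK, hD.maxAverage_child hu h.mem hK hKI hl, hc]
        rw [hD.squareMass_eq hK, hav, ← mul_assoc, ← mul_assoc, hmm K hK]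
        have hy := mul_le_add_rpow_mul_rpow hq.le hmK.le hmI
        have h1 : m K * squareArea K + m K * squareArea K / (q - 1) =
            q * m K * (squareArea K / (q - 1)) := by field_simp; ring
        have h2 : m I * squareArea K + m I ^ (1 - q) * m K ^ q * squareArea K / (q - 1) =
            ((q - 1) * m I + m K ^ q * m I ^ (1 - q)) * (squareArea K / (q - 1)) := by
          field_simp
        rw [h1, h2]
        exact mul_le_mul_of_nonneg_right hy (by positivity)
    have hmass := hD.squareMass_children hΩ hu h
    have htn : 0 ≤ (∫⁻ z in squareTop I ∩ Ω, ‖u z‖ₑ ∂area).toReal := ENNReal.toReal_nonneg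
    have hnn : ∀ K ∈ D, 0 ≤ m K * squareArea K + m K ^ (1 - q) * squareMass Ω u K / (q - 1) := by
      intro K hK
      have h1 := hm0 K hK
      have h2 := hD.squareArea_pos hK
      have h3 := squareMass_nonneg Ω u K
      positivity
    have hT := hD.topArea_pos h.mem
    rw [hD.lintegral_const_squareTop h.mem m hmI.le,
      ← ENNReal.ofReal_add (hnn _ h.mem₁) (hnn _ h.mem₂),
      ← ENNReal.ofReal_add (by positivity) (add_nonneg (hnn _ h.mem₁) (hnn _ h.mem₂))]
    refine ENNReal.ofReal_le_ofReal ?_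
    have c1 := child I₁ h.mem₁ hsub₁ h.length₁
    have c2 := child I₂ h.mem₂ hsub₂ h.length₂
    have hA := squareArea_children h
    have c3 : squareMass Ω u I₁ + squareMass Ω u I₂ ≤ squareMass Ω u I := by linarith
    rw [← hA]
    calc _ ≤ m I * topArea I + ((m I * squareArea I₁ +
            m I ^ (1 - q) * squareMass Ω u I₁ / (q - 1)) + (m I * squareArea I₂ +
            m I ^ (1 - q) * squareMass Ω u I₂ / (q - 1))) := by gcongr
      _ = m I * (topArea I + squareArea I₁ + squareArea I₂) +
            m I ^ (1 - q) / (q - 1) * (squareMass Ω u I₁ + squareMass Ω u I₂) := by ring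
      _ ≤ m I * (topArea I + squareArea I₁ + squareArea I₂) +
            m I ^ (1 - q) / (q - 1) * squareMass Ω u I := by gcongr
      _ = _ := by ring
  refine key.trans (ENNReal.ofReal_le_ofReal ?_)
  have hmI := hm0 I hI
  have hA := hD.squareArea_pos hI
  have h1 : m I ^ (1 - q) * squareMass Ω u I ≤ m I * squareArea I := by
    rw [hD.squareMass_eq hI]
    calc m I ^ (1 - q) * (squareAverage Ω u I * squareArea I)
        ≤ m I ^ (1 - q) * (m I ^ q * squareArea I) := by
          rw [hmq I hI]
          have := hD.squareAverage_le_maxAverage hu hI hI le_rfl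
          gcongr
      _ = _ := by rw [← mul_assoc, hmm I hI]
  have h2 := div_le_div_of_nonneg_right h1 hq1.le
  have h3 : q / (q - 1) * m I * squareArea I = m I * squareArea I +
      m I * squareArea I / (q - 1) := by field_simp; ring
  change _ ≤ q / (q - 1) * m I * squareArea I
  linarith

/-- Hölder's inequality for the average of `w`, in terms of the maximal function of `w ^ q`. -/
theorem lintegral_le_maxAverage_rpow (hD : IsDyadicGrid D) {w : ℂ → ℝ}
    {q : ℝ} (hq : 1 < q) (hw : ∀ᵐ z ∂(area.restrict Ω), 0 < w z)
    (hu : IntegrableOn (fun z => w z ^ q) Ω area) (hI : I ∈ D)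
    (hpos : 0 < maxAverage D Ω (fun z => w z ^ q) I) :
    ∫⁻ z in carlesonSquare I ∩ Ω, ‖w z‖ₑ ∂area ≤
      ENNReal.ofReal (maxAverage D Ω (fun z => w z ^ q) I ^ (1 / q) * squareArea I) := by
  have hq0 : 0 < q := by linarith
  have hq1 : 0 < q - 1 := by linarith
  set μ := maxAverage D Ω (fun z => w z ^ q) I with hμ
  set m := μ ^ (1 / q) with hm
  have hm0 : 0 < m := Real.rpow_pos_of_pos hpos _
  have hmq : m ^ q = μ := by
    rw [hm, ← Real.rpow_mul hpos.le, one_div_mul_cancel hq0.ne', Real.rpow_one]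
  have hmm : m ^ (1 - q) * m ^ q = m := by
    rw [← Real.rpow_add hm0, sub_add_cancel, Real.rpow_one]
  have hA := hD.squareArea_pos hI
  have hc : 0 ≤ m ^ (1 - q) / q := by positivity
  have hd : 0 ≤ (q - 1) / q * m := by positivity
  -- Young's inequality with the constant `m`, integrated over the square, replaces Hölder's
  -- inequality: the two terms contribute the fractions `(q - 1) / q` and `1 / q` of `m * squareArea
  -- I`.
  calc ∫⁻ z in carlesonSquare I ∩ Ω, ‖w z‖ₑ ∂area
      ≤ ∫⁻ z in carlesonSquare I ∩ Ω, (ENNReal.ofReal ((q - 1) / q * m) +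
          ENNReal.ofReal (m ^ (1 - q) / q) * ‖w z ^ q‖ₑ) ∂area := by
        refine lintegral_mono_ae ?_
        filter_upwards [ae_restrict_of_ae_restrict_of_subset Set.inter_subset_right hw] with z hz
        rw [Real.enorm_eq_ofReal hz.le, Real.enorm_eq_ofReal (Real.rpow_nonneg hz.le _),
          ← ENNReal.ofReal_mul hc, ← ENNReal.ofReal_add hd
            (mul_nonneg hc (Real.rpow_nonneg hz.le _))]
        refine ENNReal.ofReal_le_ofReal ?_
        have h1 := mul_le_add_rpow_mul_rpow hq.le hz.le hm0
        calc w z = q * w z / q := by field_simp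
          _ ≤ ((q - 1) * m + w z ^ q * m ^ (1 - q)) / q := by gcongr
          _ = _ := by ring
    _ = ENNReal.ofReal ((q - 1) / q * m) * area (carlesonSquare I ∩ Ω) +
          ENNReal.ofReal (m ^ (1 - q) / q) *
            ENNReal.ofReal (squareMass Ω (fun z => w z ^ q) I) := by
        rw [lintegral_add_left measurable_const, setLIntegral_const,
          lintegral_const_mul' _ _ ENNReal.ofReal_ne_top, ofReal_squareMass hu]
    _ ≤ ENNReal.ofReal ((q - 1) / q * m) * ENNReal.ofReal (squareArea I) +
          ENNReal.ofReal (m ^ (1 - q) / q) *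
            ENNReal.ofReal (squareMass Ω (fun z => w z ^ q) I) := by
        rw [← hD.area_carlesonSquare hI]
        gcongr
        exact Set.inter_subset_left
    _ = ENNReal.ofReal ((q - 1) / q * m * squareArea I +
          m ^ (1 - q) / q * squareMass Ω (fun z => w z ^ q) I) := by
        rw [← ENNReal.ofReal_mul hd, ← ENNReal.ofReal_mul hc, ← ENNReal.ofReal_add
          (by positivity) (mul_nonneg hc (squareMass_nonneg _ _ _))]
    _ ≤ _ := by
        refine ENNReal.ofReal_le_ofReal ?_
        have h1 : squareMass Ω (fun z => w z ^ q) I ≤ m ^ q * squareArea I := by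
          rw [hD.squareMass_eq hI, hmq]
          exact mul_le_mul_of_nonneg_right
            (hD.squareAverage_le_maxAverage hu hI hI le_rfl) hA.le
        calc _ ≤ (q - 1) / q * m * squareArea I + m ^ (1 - q) / q * (m ^ q * squareArea I) := by
              gcongr
          _ = (q - 1) / q * m * squareArea I + (m ^ (1 - q) * m ^ q) * squareArea I / q := by ring
          _ = m * squareArea I := by rw [hmm]; field_simp; ring

end IsDyadicGrid

/-! ### Construction of the extension. -/

open scoped Classical in
/-- The extension of a weight on `Ω` by a power of a maximal function. -/
def maxExtension (D : Set (Set ℂ)) (Ω : Set ℂ) (w : ℂ → ℝ) (q : ℝ) (z : ℂ) : ℝ :=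
  if z ∈ Ω then w z else maxAverage D Ω (fun z => w z ^ q) (arcOf D z) ^ (1 / q)

theorem maxExtension_of_mem {D : Set (Set ℂ)} {Ω : Set ℂ} {w : ℂ → ℝ} {q : ℝ} {z : ℂ}
    (hz : z ∈ Ω) : maxExtension D Ω w q z = w z := if_pos hz

theorem maxExtension_of_notMem {D : Set (Set ℂ)} {Ω : Set ℂ} {w : ℂ → ℝ} {q : ℝ} {z : ℂ}
    (hz : z ∉ Ω) :
    maxExtension D Ω w q z = maxAverage D Ω (fun z => w z ^ q) (arcOf D z) ^ (1 / q) :=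
  if_neg hz

namespace IsDyadicGrid

variable {D : Set (Set ℂ)} {Ω : Set ℂ}

/-- The function is constant on each of the countably many top halves, which cover almost all of the
disc. -/
theorem aemeasurable_comp_arcOf (hD : IsDyadicGrid D) (φ : Set ℂ → ℝ) :
    AEMeasurable (fun z => φ (arcOf D z)) area := by
  have : Countable D := hD.countable.to_subtype
  have hU : area.restrict (⋃ I : D, topHalf I.1) = area := by
    rw [Measure.restrict_eq_self_of_ae_mem]
    filter_upwards [hD.ae_mem_topHalf] with z hz
    obtain ⟨I, hI, hzI, -⟩ := hz
    exact Set.mem_iUnion.2 ⟨⟨I, hI⟩, hzI⟩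
  rw [← hU, aemeasurable_iUnion_iff]
  rintro ⟨I, hI⟩
  refine (aemeasurable_const (b := φ I)).congr ?_
  filter_upwards [ae_restrict_mem (hD.measurableSet_topHalf hI)] with z hz
  rw [hD.arcOf_eq hI hz]

theorem exists_mem_topHalf_of_ae (hD : IsDyadicGrid D) {I : Set ℂ} (hI : I ∈ D)
    (hIΩ : topHalf I ⊆ Ω) {p : ℂ → Prop} (h : ∀ᵐ z ∂(area.restrict Ω), p z) :
    ∃ z ∈ topHalf I, p z := by
  have hne : area.restrict (topHalf I) ≠ 0 := by
    rw [Ne, Measure.restrict_eq_zero, hD.area_topHalf hI, ENNReal.ofReal_eq_zero, not_le]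
    exact hD.topArea_pos hI
  have := ae_neBot.2 hne
  exact ((ae_restrict_mem (hD.measurableSet_topHalf hI)).and
    (ae_restrict_of_ae_restrict_of_subset hIΩ h)).exists

end IsDyadicGrid

/-- A weight of bounded oscillation on a union of top halves, with a power `q > 1` in `B₁`, extends
to a `B₁` weight of bounded oscillation on the disc. -/
theorem exists_extension {D : Set (Set ℂ)} (hD : IsDyadicGrid D) {Ω : Set ℂ}
    (hΩ : MeasurableSet Ω)
    (hΩT : ∀ z ∈ Ω, ∃ I ∈ D, z ∈ topHalf I ∧ topHalf I ⊆ Ω)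
    {I₀ : Set ℂ} (hI₀ : I₀ ∈ D) (hI₀Ω : topHalf I₀ ⊆ Ω) {w : ℂ → ℝ}
    (hw : IsDyadicBHO D Ω w) {q : ℝ} (hq : 1 < q) (hwq : MemB1 D Ω (fun z => w z ^ q)) :
    ∃ W : ℂ → ℝ, MemB1 D disc W ∧ IsDyadicBHO D disc W ∧
      (∀ᵐ z ∂(area.restrict Ω), W z = w z) ∧
      b1Const D disc W ≤ (2 * q - 1) / (q - 1) *
        (max 1 (b1Const D Ω (fun z => w z ^ q))) ^ (1 / q) * Real.exp (3 * oscConst D Ω w) ∧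
      oscConst D disc W ≤
        Real.log (64 * b1Const D Ω (fun z => w z ^ q)) / q + 3 * oscConst D Ω w := by
  obtain ⟨hL0, hL⟩ := oscBound_oscConst hw.exists_bound
  have hCae := ae_maximalOp_le_b1Const hwq.exists_bound
  set L := oscConst D Ω w with hLdef
  set C := b1Const D Ω (fun z => w z ^ q) with hCdef
  have hu := hwq.integrable
  have hpos := hw.pos
  have hq0 : 0 < q := by linarith
  have hq1 : 0 < q - 1 := by linarith
  have hC0 : 0 ≤ C := Real.sInf_nonneg fun x hx => hx.1.le
  set μ := maxAverage D Ω (fun z => w z ^ q) with hμ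
  have hupper := hD.ae_le_squareAverage hpos hL hq0.le hu
  have hlower : ∀ᵐ z ∂(area.restrict Ω), ∀ I ∈ D, z ∈ carlesonSquare I →
      squareAverage Ω (fun z => w z ^ q) I ≤ C * w z ^ q := by
    filter_upwards [hCae, hpos, ae_restrict_mem hΩ] with z hz hz0 hzΩ I hI hzI
    exact hD.squareAverage_le_of_maximalOp hu (by positivity) hzΩ hz hI hzI
  have heq : Real.exp L ^ q = Real.exp (L * q) := (Real.exp_mul L q).symm
  -- At a generic point of `T(I₀)` the upper and lower bounds for `w ^ q` can be chained. This gives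
  -- `C > 0` and a lower bound for `log C`, which may be negative.
  have hbase : 0 < squareAverage Ω (fun z => w z ^ q) I₀ ∧ 1 ≤ 4 * Real.exp (L * q) * C := by
    obtain ⟨z, hzI, ⟨⟨h1, h2⟩, h3⟩, h4⟩ := hD.exists_mem_topHalf_of_ae hI₀ hI₀Ω
      (((hupper.and hlower).and hpos).and (ae_restrict_of_ae hD.ae_mem_squareTop_iff))
    have h5 := h1 I₀ hI₀ hzI hI₀Ω
    have h6 := h2 I₀ hI₀ (squareTop_subset I₀ ((h4 I₀ hI₀).1 hzI))
    have h7 : 0 < w z ^ q := Real.rpow_pos_of_pos h3 q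
    rw [heq] at h5
    have he := Real.exp_pos (L * q)
    constructor
    · exact pos_of_mul_pos_right (h7.trans_le h5) (by positivity)
    · refine le_of_mul_le_mul_right ?_ h7
      have := mul_le_mul_of_nonneg_left h6 (show 0 ≤ 4 * Real.exp (L * q) by positivity)
      linarith
  have hCpos : 0 < C := by
    rcases hC0.eq_or_lt with h | h
    · have := hbase.2; rw [← h] at this; norm_num at this
    · exact h
  have hμpos : ∀ I ∈ D, 0 < μ I := by
    intro I hI
    refine lt_of_lt_of_le ?_ (hD.squareAverage_le_maxAverage hu hI hD.circle_mem
      (hD.subset_circle hI))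
    refine div_pos ?_ (hD.squareArea_pos hD.circle_mem)
    refine lt_of_lt_of_le ?_ (hD.squareMass_mono hu hI₀ hD.circle_mem (hD.subset_circle hI₀))
    rw [hD.squareMass_eq hI₀]
    exact mul_pos hbase.1 (hD.squareArea_pos hI₀)
  set W := maxExtension D Ω w q with hW
  -- the size of `W` on the top halves
  have hWsize : ∀ᵐ z ∂area, ∃ I ∈ D, z ∈ topHalf I ∧ z ∈ squareTop I ∧ 0 < W z ∧
      (z ∉ Ω → W z = μ I ^ (1 / q)) ∧
      (z ∈ Ω → μ I ≤ C * W z ^ q ∧ W z ^ q ≤ 4 * Real.exp (L * q) * μ I) := by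
    filter_upwards [hD.ae_mem_topHalf, (ae_restrict_iff' hΩ).1 hupper,
      (ae_restrict_iff' hΩ).1 hlower, (ae_restrict_iff' hΩ).1 hpos] with z hz h1 h2 h3
    obtain ⟨I, hI, hzI, hzI'⟩ := hz
    refine ⟨I, hI, hzI, hzI', ?_⟩
    by_cases hzΩ : z ∈ Ω
    · have hWz : W z = w z := maxExtension_of_mem hzΩ
      rw [hWz]
      refine ⟨h3 hzΩ, fun h => absurd hzΩ h, fun _ => ⟨?_, ?_⟩⟩
      · exact IsDyadicGrid.maxAverage_le hI fun J hJ hIJ => h2 hzΩ J hJ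
          ((hD.subset_iff_mem_carlesonSquare hI hJ hzI').2 hIJ)
      · obtain ⟨J, hJ, hzJ, hJΩ⟩ := hΩT z hzΩ
        obtain rfl := hD.eq_of_mem_topHalf hI hJ hzI hzJ
        refine (h1 hzΩ I hI hzI hJΩ).trans ?_
        rw [heq]
        have := hD.squareAverage_le_maxAverage hu hI hI le_rfl
        gcongr
    · have hWz : W z = μ I ^ (1 / q) := by
        rw [hW, maxExtension_of_notMem hzΩ, hD.arcOf_eq hI hzI]
      rw [hWz]
      exact ⟨Real.rpow_pos_of_pos (hμpos I hI) _, fun _ => rfl, fun h => absurd h hzΩ⟩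
  have hWpos : ∀ᵐ z ∂area, 0 < W z := by
    filter_upwards [hWsize] with z hz
    obtain ⟨I, -, -, -, h, -⟩ := hz
    exact h
  have hWm : AEMeasurable W area := by
    rw [← Measure.restrict_univ (μ := area), ← Set.union_compl_self Ω, aemeasurable_union_iff]
    constructor
    · refine hw.aemeasurable.congr ?_
      filter_upwards [ae_restrict_mem hΩ] with z hz using (maxExtension_of_mem hz).symm
    · refine (hD.aemeasurable_comp_arcOf (fun I => μ I ^ (1 / q))).restrict.congr ?_
      filter_upwards [ae_restrict_mem hΩ.compl] with z hz using (maxExtension_of_notMem hz).symm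
  have hsquare : ∀ I ∈ D, ∫⁻ z in carlesonSquare I ∩ disc, ‖W z‖ₑ ∂area ≤
      ENNReal.ofReal ((2 * q - 1) / (q - 1) * μ I ^ (1 / q) * squareArea I) := by
    intro I hI
    have hm := Real.rpow_pos_of_pos (hμpos I hI) (1 / q)
    have hA := hD.squareArea_pos hI
    have hS := hD.measurableSet_carlesonSquare hI
    calc ∫⁻ z in carlesonSquare I ∩ disc, ‖W z‖ₑ ∂area
        ≤ ∫⁻ z in (carlesonSquare I ∩ Ω) ∪ (carlesonSquare I ∩ Ωᶜ), ‖W z‖ₑ ∂area :=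
          lintegral_mono_set (by rw [Set.inter_union_compl]; exact Set.inter_subset_left)
      _ ≤ ∫⁻ z in carlesonSquare I ∩ Ω, ‖W z‖ₑ ∂area +
            ∫⁻ z in carlesonSquare I ∩ Ωᶜ, ‖W z‖ₑ ∂area := lintegral_union_le _ _ _
      _ = ∫⁻ z in carlesonSquare I ∩ Ω, ‖w z‖ₑ ∂area +
            ∫⁻ z in carlesonSquare I ∩ Ωᶜ, ‖μ (arcOf D z) ^ (1 / q)‖ₑ ∂area := by
          congr 1
          · refine setLIntegral_congr_fun (hS.inter hΩ) fun z hz => ?_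
            simp only [hW, maxExtension_of_mem hz.2]
          · refine setLIntegral_congr_fun (hS.inter hΩ.compl) fun z hz => ?_
            simp only [hW, maxExtension_of_notMem hz.2, hμ]
      -- The contributions of `Ω` and of its complement add up to `1 + q / (q - 1)`.
      _ ≤ ENNReal.ofReal (μ I ^ (1 / q) * squareArea I) +
            ENNReal.ofReal (q / (q - 1) * μ I ^ (1 / q) * squareArea I) := by
          refine add_le_add (hD.lintegral_le_maxAverage_rpow hq hpos hu hI (hμpos I hI)) ?_
          exact (lintegral_mono_set Set.inter_subset_left).trans
            (hD.lintegral_maxAverage_rpow_le hΩ hu hμpos hq hI)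
      _ = _ := by
          rw [← ENNReal.ofReal_add (by positivity) (by positivity)]
          congr 1; field_simp; ring
  -- Averages over `S(I) ∩ Ω` are divided by the full area of `S(I)`, so `C` can be less than 1,
  -- whereas off `Ω` the factor has to be at least 1.
  set M := (max 1 C) ^ (1 / q) with hM
  have hM1 : 1 ≤ M := Real.one_le_rpow (le_max_left 1 C) (by positivity)
  have hκ : 0 < (2 * q - 1) / (q - 1) := div_pos (by linarith) hq1
  have hB1 : B1Bound D disc W ((2 * q - 1) / (q - 1) * M) := by
    refine ⟨by positivity, ?_⟩
    rw [area_restrict_disc]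
    filter_upwards [hWsize] with z hz
    obtain ⟨I, hI, -, hzI, hW0, hout, hin⟩ := hz
    have hmW : μ I ^ (1 / q) ≤ M * W z := by
      by_cases hzΩ : z ∈ Ω
      · have h1 := (hin hzΩ).1
        have h2 : μ I ≤ max 1 C * W z ^ q := h1.trans (by gcongr; exact le_max_right _ _)
        have h3 := Real.rpow_le_rpow (hμpos I hI).le h2 (show 0 ≤ 1 / q by positivity)
        rwa [Real.mul_rpow (by positivity) (by positivity), ← Real.rpow_mul hW0.le,
          mul_one_div_cancel hq0.ne', Real.rpow_one] at h3
      · rw [← hout hzΩ]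
        exact le_mul_of_one_le_left hW0.le hM1
    refine hD.maximalOp_le fun J hJ hzJ => (hsquare J hJ).trans (ENNReal.ofReal_le_ofReal ?_)
    have hIJ := (hD.subset_iff_mem_carlesonSquare hI hJ hzI).1 hzJ
    have h1 := Real.rpow_le_rpow (hμpos J hJ).le (hD.maxAverage_anti hu hI hJ hIJ)
      (show 0 ≤ 1 / q by positivity)
    have h2 := hD.squareArea_pos hJ
    rw [mul_assoc ((2 * q - 1) / (q - 1)) M]
    exact mul_le_mul_of_nonneg_right (mul_le_mul_of_nonneg_left (h1.trans hmW) hκ.le) h2.le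
  set R := Real.log (64 * C) / q + 3 * L with hR
  have hosc : OscBound D disc W R := by
    set l := Real.log 4 / q with hl
    set c := Real.log C / q with hc
    have hl0 : 0 < l := div_pos (Real.log_pos (by norm_num)) hq0
    have hcl : 0 ≤ l + L + c := by
      have h1 := Real.log_nonneg hbase.2
      rw [Real.log_mul (by positivity) hCpos.ne',
        Real.log_mul (by norm_num) (Real.exp_pos _).ne', Real.log_exp] at h1
      have h2 : l + L + c = (Real.log 4 + L * q + Real.log C) / q := by
        rw [hl, hc]; field_simp
      rw [h2]; positivity
    -- Splitting off `l + L + c ≥ 0` shows that `R` dominates each of `l`, `L`, `c` and `l + L`,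
    -- which is all that the cases below require.
    have hRl : R = 3 * l + c + 3 * L := by
      rw [hR, hl, hc, Real.log_mul (by norm_num) hCpos.ne', show (64 : ℝ) = 4 ^ 3 by norm_num,
        Real.log_pow]
      push_cast; ring
    refine ⟨by linarith, ?_⟩
    have hsize : ∀ᵐ z ∂area, ∃ I ∈ D, z ∈ topHalf I ∧
        (z ∉ Ω → Real.log (W z) = Real.log (μ I) / q) ∧
        (z ∈ Ω → Real.log (μ I) / q ≤ c + Real.log (W z) ∧
          Real.log (W z) ≤ l + L + Real.log (μ I) / q) := by
      filter_upwards [hWsize] with z hz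
      obtain ⟨I, hI, hzI, -, hW0, hout, hin⟩ := hz
      refine ⟨I, hI, hzI, fun h => ?_, fun h => ?_⟩
      · rw [hout h, Real.log_rpow (hμpos I hI)]; ring
      · obtain ⟨h1, h2⟩ := hin h
        have hWq : 0 < W z ^ q := Real.rpow_pos_of_pos hW0 q
        have h3 := Real.log_le_log (hμpos I hI) h1
        have h4 := Real.log_le_log hWq h2
        rw [Real.log_mul hCpos.ne' hWq.ne', Real.log_rpow hW0] at h3
        rw [Real.log_mul (by positivity) (hμpos I hI).ne',
          Real.log_mul (by norm_num) (Real.exp_pos _).ne', Real.log_exp, Real.log_rpow hW0] at h4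
        constructor
        · rw [div_le_iff₀ hq0, hc]
          have : (Real.log C / q + Real.log (W z)) * q = Real.log C + q * Real.log (W z) := by
            field_simp
          linarith
        · have : l + L + Real.log (μ I) / q = (Real.log 4 + L * q + Real.log (μ I)) / q := by
            rw [hl]; field_simp
          rw [this, le_div_iff₀ hq0]
          linarith
    rw [area_restrict_disc]
    filter_upwards [hsize, (ae_restrict_iff' hΩ).1 hL] with z hz hzL
    have hzL' : ∀ᵐ ζ ∂area, z ∈ Ω → ζ ∈ Ω →
        |Real.log (w z) - Real.log (w ζ)| ≤ L * (1 + dyadicDist D z ζ) := by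
      by_cases hzΩ : z ∈ Ω
      · filter_upwards [(ae_restrict_iff' hΩ).1 (hzL hzΩ)] with ζ hζ _ using hζ
      · exact Filter.Eventually.of_forall fun ζ h => absurd h hzΩ
    filter_upwards [hsize, hzL'] with ζ hζ hζL
    obtain ⟨I, hI, hzI, hzout, hzin⟩ := hz
    obtain ⟨J, hJ, hζJ, hζout, hζin⟩ := hζ
    obtain ⟨-, -, -, -, hβ, -, -⟩ := hD.dyadicDist_spec hI hJ hzI hζJ
    set β := dyadicDist D z ζ
    have hd : |Real.log (μ I) / q - Real.log (μ J) / q| ≤ l * β := by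
      rw [← sub_div, abs_div, abs_of_pos hq0, hl, div_mul_eq_mul_div]
      exact div_le_div_of_nonneg_right (hD.abs_log_maxAverage_sub_le hu hμpos hI hJ hzI hζJ) hq0.le
    obtain ⟨hd1, hd2⟩ := abs_le.1 hd
    have hlR : l * β ≤ R * β := mul_le_mul_of_nonneg_right (by linarith) hβ
    -- Inside `Ω` the bound is that of `w`, outside that of `log μ / q`. In the mixed cases
    -- replacing `log W` by `log μ / q` at the point of `Ω` costs `c` on one side and `l + L` on the
    -- other.
    by_cases hzΩ : z ∈ Ω <;> by_cases hζΩ : ζ ∈ Ω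
    · rw [hW, maxExtension_of_mem hzΩ, maxExtension_of_mem hζΩ]
      refine (hζL hzΩ hζΩ).trans (mul_le_mul_of_nonneg_right ?_ (by linarith))
      linarith
    · obtain ⟨h1, h2⟩ := hzin hzΩ
      rw [hζout hζΩ, abs_le]
      constructor <;> linarith
    · obtain ⟨h1, h2⟩ := hζin hζΩ
      rw [hzout hzΩ, abs_le]
      constructor <;> linarith
    · rw [hzout hzΩ, hζout hζΩ]
      refine hd.trans ?_
      linarith
  have hint : IntegrableOn W disc area := by
    rw [IntegrableOn, area_restrict_disc]
    refine ⟨hWm.aestronglyMeasurable, ?_⟩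
    rw [HasFiniteIntegral]
    have hae : (Set.univ : Set ℂ) =ᵐ[area] (carlesonSquare circle ∩ disc : Set ℂ) := by
      filter_upwards [hD.ae_mem_topHalf] with z hz
      obtain ⟨I, hI, -, hzI⟩ := hz
      have := hD.carlesonSquare_subset hI hD.circle_mem (hD.subset_circle hI)
        (squareTop_subset I hzI)
      exact propext ⟨fun _ => ⟨this, this.1⟩, fun _ => trivial⟩
    rw [← setLIntegral_univ, setLIntegral_congr hae]
    exact (hsquare _ hD.circle_mem).trans_lt ENNReal.ofReal_lt_top
  refine ⟨W, ⟨hint, ?_, _, hB1⟩, ⟨?_, ?_, _, hosc⟩, ?_, ?_, ?_⟩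
  · rw [area_restrict_disc]; exact hWpos.mono fun _ h => h.le
  · rwa [area_restrict_disc]
  · rwa [area_restrict_disc]
  · filter_upwards [ae_restrict_mem hΩ] with z hz using maxExtension_of_mem hz
  · refine (csInf_le ⟨(0 : ℝ), fun x (hx : B1Bound D disc W x) => hx.1.le⟩ hB1).trans ?_
    -- `W` satisfies the `B₁` bound without the exponential, which is at least 1.
    exact le_mul_of_one_le_right (by positivity) (Real.one_le_exp (by linarith))
  · exact csInf_le ⟨(0 : ℝ), fun x (hx : OscBound D disc W x) => hx.1⟩ hosc

end DyadicBB

end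

theorem theorem2 (D : Set (Set ℂ)) (hD : DyadicBB.IsDyadicGrid D)
    (𝒥 : Set (Set ℂ)) (h𝒥 : 𝒥 ⊆ D) (hne : 𝒥.Nonempty)
    (Ω : Set ℂ) (hΩ : Ω = ⋃ I ∈ 𝒥, DyadicBB.topHalf I) (w : ℂ → ℝ) :
    (DyadicBB.IsDyadicBHO D Ω w →
      ∀ q : ℝ, 1 < q → DyadicBB.MemB1 D Ω (fun z => w z ^ q) →
        ∃ W : ℂ → ℝ,
          DyadicBB.MemB1 D DyadicBB.disc W ∧
          DyadicBB.IsDyadicBHO D DyadicBB.disc W ∧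
          (∀ᵐ z ∂(DyadicBB.area.restrict Ω), W z = w z) ∧
          DyadicBB.b1Const D DyadicBB.disc W ≤
            (2 * q - 1) / (q - 1) *
              (max 1 (DyadicBB.b1Const D Ω (fun z => w z ^ q))) ^ (1 / q) *
              Real.exp (3 * DyadicBB.oscConst D Ω w) ∧
          DyadicBB.oscConst D DyadicBB.disc W ≤
            Real.log (64 * DyadicBB.b1Const D Ω (fun z => w z ^ q)) / q +
              3 * DyadicBB.oscConst D Ω w) ∧
    ((∃ W : ℂ → ℝ,
        DyadicBB.MemB1 D DyadicBB.disc W ∧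
        DyadicBB.IsDyadicBHO D DyadicBB.disc W ∧
        (∀ᵐ z ∂(DyadicBB.area.restrict Ω), w z = W z)) →
      ∃ q : ℝ, 1 < q ∧ DyadicBB.MemB1 D Ω (fun z => w z ^ q)) := by
  have hsub : ∀ I ∈ 𝒥, DyadicBB.topHalf I ⊆ Ω := fun I hI => by
    rw [hΩ]; exact Set.subset_biUnion_of_mem (u := fun I => DyadicBB.topHalf I) hI
  have hΩd : Ω ⊆ DyadicBB.disc := by
    rw [hΩ]; exact Set.iUnion₂_subset fun I _ z hz => hz.1
  obtain ⟨I₀, hI₀⟩ := hne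
  refine ⟨fun hw q hq hwq => ?_, fun ⟨W, hW, hosc, hwW⟩ =>
    DyadicBB.exists_rpow_memB1 hD hΩd hW hosc hwW⟩
  refine DyadicBB.exists_extension hD ?_ ?_ (h𝒥 hI₀) (hsub I₀ hI₀) hw hq hwq
  · rw [hΩ]
    exact MeasurableSet.biUnion (hD.countable.mono h𝒥) fun I hI =>
      hD.measurableSet_topHalf (h𝒥 hI)
  · intro z hz
    rw [hΩ] at hz
    obtain ⟨I, hI, hzI⟩ := Set.mem_iUnion₂.1 hz
    exact ⟨I, h𝒥 hI, hzI, hsub I hI⟩
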